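/- Let $V=\{1,\dots,n\}$, let $L$ be a finite set of $\ell$ colors and let $\gamma\notin L$ be the negative label. An instance of Chromatic Correlation Clustering is a map $\phi:\binom V2\to L\cup\{\gamma\}$. A chromatic clustering $\Phi$ is a partition of $V$ together with a color in $L$ for each cluster with at least two vertices; for $u\ne v$ write $\Phi(u,v)\in L$ for the color of the common cluster of $u$ and $v$, and $\Phi(u,v)=\gamma$ if they lie in different clusters. Its cost is $\mathrm{obj}(\Phi)=|\{uv\in\binom V2:\phi(uv)\neq\Phi(u,v)\}|$, and $\mathrm{OPT}$ is the least cost of a chromatic clustering. **Theorem.** There are a (deterministic) algorithm and absolute constants $A,B,d$ such that for all $n,\ell$, every instance $\phi$ and every $0<\varepsilon\le 1$ (given to the algorithm as the integer $\lceil 1/\varepsilon\rceil$), the algorithm halts after at most $A\,(n+\ell+1/\varepsilon)^d$ steps and outputs a chromatic clustering $\Phi^p$ and, for each color $c\in L$, a set $E^{2;c}\subseteq\binom V2$ of admissible edges of color $c$, with the following properties. 1. Every cluster $K$ of $\Phi^p$ with at least two vertices is an atom: each $u\in K$ satisfies $|\{v\in V\setminus\{u\}:\phi(uv)\ne\Phi^p(u,v)\}|<\frac1{10}|K|$.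 Every admissible edge joins two different clusters of $\Phi^p$. 2. There is a chromatic clustering $\Phi_1^*$ with $\mathrm{obj}(\Phi_1^*)\le(1+\varepsilon)\,\mathrm{OPT}$ such that every atom of $\Phi^p$ lies inside a cluster of $\Phi_1^*$ of the same color, and such that, whenever $\Phi_1^*(u,v)=c\in L$, either $u$ and $v$ lie in the same atom or $uv\in E^{2;c}$. 3. $\sum_{c\in L}|E^{2;c}|\le \dfrac{B}{\varepsilon^2}\,\mathrm{OPT}$. The steps are those of a random access machine on natural numbers with unit cost for addition, truncated subtraction and array access, and a cost of at least the bit lengths of the factors for a multiplication. -/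

import Mathlib

namespace CCC

/-! Chromatic correlation clustering on the vertex set `Fin n` with colour set `L = Fin ℓ`. -/

/-- The set of labels `L ∪ {0, γ}`: `zero` is the label of the diagonal, `gamma` the negative label. -/
inductive Label (ℓ : ℕ) : Type
  | zero : Label ℓ
  | color (c : Fin ℓ) : Label ℓ
  | gamma : Label ℓ
  deriving DecidableEq

/-- A map `φ : (V choose 2) → L ∪ {γ}`, as a symmetric function on `V × V` that takes the
value `0` exactly on the diagonal. -/
structure EdgeColoring (n ℓ : ℕ) where
  /-- the label of a pair -/
  label : Fin n → Fin n → Label ℓ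
  zero_iff : ∀ u v, label u v = Label.zero ↔ u = v
  symm : ∀ u v, label u v = label v u

/-- A chromatic clustering as a binary function: `Φ(u,v)` is the colour of the common cluster of
`u ≠ v`, and `γ` if `u` and `v` are in different clusters. -/
structure ChromaticClustering (n ℓ : ℕ) extends EdgeColoring n ℓ where
  cluster : ∀ u v c, label u v = Label.color c → ∀ w, w ≠ u → w ≠ v →
    label u w = label v w ∧ (label u w = Label.color c ∨ label u w = Label.gamma)

/-- The clustering into singletons. -/
instance (n ℓ : ℕ) : Inhabited (ChromaticClustering n ℓ) where
  default :=
    { label := fun u v => if u = v then Label.zero else Label.gamma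
      zero_iff := by intro u v; by_cases h : u = v <;> simp [h]
      symm := by intro u v; simp only [eq_comm]
      cluster := by intro u v c h; by_cases h' : u = v <;> simp [h'] at h }

/-- `d₀(φ_u, Φ_u)`: the number of vertices `v` with `φ(u,v) ≠ Φ(u,v)`. -/
def EdgeColoring.d0 {n ℓ : ℕ} (φ Φ : EdgeColoring n ℓ) (u : Fin n) : ℕ :=
  (Finset.univ.filter fun v : Fin n => φ.label u v ≠ Φ.label u v).card

/-- The cost of a clustering `Φ` on the input `φ`: the number of unordered pairs `uv` in which the
clustering disagrees with the input. -/
def EdgeColoring.obj {n ℓ : ℕ} (φ : EdgeColoring n ℓ) (Φ : ChromaticClustering n ℓ) : ℕ :=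
  (Finset.univ.filter fun p : Fin n × Fin n =>
    p.1 < p.2 ∧ φ.label p.1 p.2 ≠ Φ.label p.1 p.2).card

/-- The optimum: the least cost of a chromatic clustering. -/
noncomputable def EdgeColoring.opt {n ℓ : ℕ} (φ : EdgeColoring n ℓ) : ℕ :=
  ⨅ Φ : ChromaticClustering n ℓ, φ.obj Φ

/-- The cluster `K_u` of `Φ` that contains `u`. -/
def ChromaticClustering.clusterOf {n ℓ : ℕ} (Φ : ChromaticClustering n ℓ) (u : Fin n) :
    Finset (Fin n) :=
  Finset.univ.filter fun v => Φ.label u v ≠ Label.gamma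

/-- The non-singleton clusters of `Φ` are atoms of `φ`, that is, almost cliques of a single colour
with almost only negative pairs around them: every vertex `u` of such a cluster `K` has
`d₀(φ_u, Φ_u) < β |K|`, where `β = 1/10`. -/
def ChromaticClustering.IsAtomic {n ℓ : ℕ} (Φ : ChromaticClustering n ℓ)
    (φ : EdgeColoring n ℓ) : Prop :=
  ∀ u, 2 ≤ (Φ.clusterOf u).card →
    ((φ.d0 Φ.toEdgeColoring u : ℕ) : ℝ) < (1 / 10 : ℝ) * ((Φ.clusterOf u).card : ℝ)

/-- `Φ ≤ Ψ`: every cluster of `Ψ` with at least two vertices lies inside a cluster of `Φ`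
of the same colour. -/
def ChromaticClustering.DoesNotBreak {n ℓ : ℕ} (Φ Ψ : ChromaticClustering n ℓ) : Prop :=
  ∀ u v c, Ψ.label u v = Label.color c → Φ.label u v = Label.color c

/-! A random access machine, programmed in a small structured language.  The memory consists of
arrays `0, 1, 2, …` of natural numbers, indexed by the natural numbers. -/

/-- A memory state: `s a i` is the entry `i` of the array `a`. -/
abbrev State : Type := ℕ → ℕ → ℕ

/-- Expressions: constants, array entries, addition, truncated subtraction, multiplication. -/
inductive Expr : Type
  | const (k : ℕ) : Expr
  | get (a : ℕ) (i : Expr) : Expr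
  | add (x y : Expr) : Expr
  | sub (x y : Expr) : Expr
  | mul (x y : Expr) : Expr

/-- The value of an expression. -/
def Expr.eval (s : State) : Expr → ℕ
  | .const k => k
  | .get a i => s a (i.eval s)
  | .add x y => x.eval s + y.eval s
  | .sub x y => x.eval s - y.eval s
  | .mul x y => x.eval s * y.eval s

/-- The number of steps for evaluating an expression: one step per operation, where a
multiplication costs in addition the bit lengths of its factors (so that numbers of superpolynomial
bit length cannot be produced in polynomial time). -/
def Expr.cost (s : State) : Expr → ℕ
  | .const _ => 1
  | .get _ i => i.cost s + 1
  | .add x y => x.cost s + y.cost s + 1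
  | .sub x y => x.cost s + y.cost s + 1
  | .mul x y => x.cost s + y.cost s + (x.eval s).size + (y.eval s).size + 1

/-- Programs. Conditions are expressions, read as true when their value is not `0`. -/
inductive Program : Type
  | skip : Program
  | assign (a : ℕ) (i x : Expr) : Program
  | seq (p q : Program) : Program
  | ite (b : Expr) (p q : Program) : Program
  | while (b : Expr) (p : Program) : Program

/-- The state after writing `x` into the entry `i` of the array `a`. -/
def State.write (s : State) (a i x : ℕ) : State :=
  Function.update s a (Function.update (s a) i x)

/-- `Runs p s t s'`: started in the state `s`, the program `p` halts after exactly `t` steps in the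
state `s'`. -/
inductive Runs : Program → State → ℕ → State → Prop
  | skip (s : State) : Runs .skip s 1 s
  | assign (s : State) (a : ℕ) (i x : Expr) :
      Runs (.assign a i x) s (i.cost s + x.cost s + 1) (s.write a (i.eval s) (x.eval s))
  | seq {p q : Program} {s s' s'' : State} {t t' : ℕ} :
      Runs p s t s' → Runs q s' t' s'' → Runs (.seq p q) s (t + t') s''
  | ite_true {b : Expr} {p q : Program} {s s' : State} {t : ℕ} :
      b.eval s ≠ 0 → Runs p s t s' → Runs (.ite b p q) s (b.cost s + t + 1) s'
  | ite_false {b : Expr} {p q : Program} {s s' : State} {t : ℕ} :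
      b.eval s = 0 → Runs q s t s' → Runs (.ite b p q) s (b.cost s + t + 1) s'
  | while_true {b : Expr} {p : Program} {s s' s'' : State} {t t' : ℕ} :
      b.eval s ≠ 0 → Runs p s t s' → Runs (.while b p) s' t' s'' →
        Runs (.while b p) s (b.cost s + t + t' + 1) s''
  | while_false {b : Expr} {p : Program} {s : State} :
      b.eval s = 0 → Runs (.while b p) s (b.cost s + 1) s

/-- The number that stands for a label in the memory: `c + 1` for the colour `c`, else `0`. -/
def Label.code {ℓ : ℕ} : Label ℓ → ℕ
  | .zero => 0
  | .color c => c.val + 1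
  | .gamma => 0

/-- The input state: the array `0` begins with `n`, `ℓ`, `k`, the array `1` holds the matrix of the
edge colouring row by row, everything else is `0`. -/
def inputState {n ℓ : ℕ} (φ : EdgeColoring n ℓ) (k : ℕ) : State := fun a i =>
  if a = 0 then
    if i = 0 then n else if i = 1 then ℓ else if i = 2 then k else 0
  else if a = 1 then
    if h : i < n * n then
      (φ.label ⟨i / n, Nat.div_lt_of_lt_mul h⟩
        ⟨i % n, Nat.mod_lt i (Nat.pos_of_ne_zero (by rintro rfl; simp at h))⟩).code
    else 0
  else 0

/-- The final state `s` displays the clustering `Φ` (matrix row by row in the array `2`) and the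
coloured edge set `E` (one `0`-`1` adjacency matrix per colour, in the array `3`). -/
def IsOutput {n ℓ : ℕ} (s : State) (Φ : ChromaticClustering n ℓ)
    (E : Fin ℓ → Finset (Sym2 (Fin n))) : Prop :=
  (∀ u v : Fin n, s 2 (u.val * n + v.val) = (Φ.label u v).code) ∧
  (∀ (c : Fin ℓ) (u v : Fin n),
    s 3 ((c.val * n + u.val) * n + v.val) = if s(u, v) ∈ E c then 1 else 0)

end CCC

/-! The algorithm needs no approximate solution of the instance: atoms and admissible edges are
defined directly from the neighbourhoods.

*Atoms.* A cluster that is cheap in some clustering almost agrees with the closed neighbourhood, in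
one colour, of each of its typical vertices. So a pair `(u, c)` is called tight if nearly all
vertices of the neighbourhood `S` of `u` in colour `c`, and `u` itself, disagree with the cluster `S`
in few places, and the hull of `(u, c)` consists of all vertices that disagree with `S` in somewhat
more places. If two hulls meet, then the neighbourhoods are close in Hamming distance, hence have a
common core vertex, hence are even closer (`EdgeColoring.IsTight.close`). This gain makes meeting an
equivalence relation on tight pairs; the hulls of the first pair of each class are the atoms. Two
exchange arguments show that an optimal clustering contains every atom in a cluster that is not much
larger (`exists_cluster_of_atom`). A vertex outside of the atoms lies in an expensive cluster, or has
many disagreements itself, so that the degrees of these vertices add up to `O(OPT)` (`sum_deg_le`).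

*The near-optimal clustering.* From an optimal clustering, a set `R` of vertices outside of the atoms
is made into singletons, where `R` minimizes the number of errors minus `1 / (2 * k)` times the sum
of the degrees in `R`. As the errors of the result include these degrees, little is lost; by
minimality, a remaining vertex `u` outside of the atoms has at least `deg u / (4 * k)` more agreeing
than negative vertices in its cluster `C` (`exists_isolate`). Therefore all degrees in `C` are
`O(k * |C|)`, and for two such vertices there are `Ω(|C| / k)` vertices `w` joined to one of them in
the colour of `C` and to the other in any colour (`le_weight_or_le_weight`).

*Admissible edges.* With each such `w` weighted by `1 / (deg w + 1)`, the weight of a pair is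
`Ω(1 / k ^ 2)`. The pairs of at least this weight are admissible. Since the weights sent out by `u`
in colour `c` sum up to its degree in colour `c`, there are `O(k ^ 2 * deg u)` of them at `u`, all
colours together, however different the degrees may be. A vertex outside of the atoms may also be
joined to an atom of which it sees a constant fraction; this makes `O(deg u)` pairs
(`sum_card_admissible_le`).

*Running time.* All these definitions are built from arithmetic and sums over vertices and colours.
`Comp` is the class of functions computed in polynomial time by the machine; it is closed under these
operations (`Comp.sum` is the essential case), so membership follows the shape of the definitions,
without any intermediate tables. -/

namespace CCC

/-! ### Polynomial-time expressions with bounded sums -/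

/-- An input of the algorithm: an instance with its numbers of vertices and colours, and the
precision parameter `k = ⌈1 / ε⌉`. -/
structure Input : Type where
  /-- the number of vertices -/
  n : ℕ
  /-- the number of colours -/
  l : ℕ
  /-- the instance -/
  φ : EdgeColoring n l
  /-- the precision -/
  k : ℕ

/-- The quantity in which running times are polynomial. The summand `2` lets every polynomial bound
take the form `I.size ^ C`. -/
def Input.size (I : Input) : ℕ := I.n + I.l + I.k + 2

/-- The types `Γ I` are contexts: the values of the variables on which a function depends. `enc`
lists the numbers that represent the variables in the memory. -/
class Ctx (Γ : Input → Type) where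
  /-- the numbers that represent the variables, the last one first -/
  enc : ∀ I, Γ I → List ℕ

instance : Ctx (fun _ => Unit) where
  enc := fun _ _ => []

instance {Γ : Input → Type} [Ctx Γ] (m : Input → ℕ) : Ctx (fun I => Γ I × Fin (m I)) where
  enc := fun I p => (p.2 : ℕ) :: Ctx.enc I p.1

/-- The state `s` still contains the input `I` in its arrays `0` and `1`. -/
def HasInput (I : Input) (s : State) : Prop :=
  s 0 = inputState I.φ I.k 0 ∧ s 1 = inputState I.φ I.k 1

/-- Between the states `s` and `s'`, only the cells from `r` on of the array `4` changed. -/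
def Frame (r : ℕ) (s s' : State) : Prop :=
  (∀ a, a ≠ 4 → s' a = s a) ∧ ∀ i < r, s' 4 i = s 4 i

/-- The function `f` of an input and a context is computable in polynomial time, and its values are
polynomially bounded. The array `4` is the working memory: the program is given a list `vs` of the
cells that hold the variables and a cell `r` beyond them. It puts the value of `f` into the cell `r`
and leaves alone all cells below `r` and all other arrays. -/
def Comp {Γ : Input → Type} [Ctx Γ] (f : ∀ I, Γ I → ℕ) : Prop :=
  ∃ (P : List ℕ → ℕ → Program) (C : ℕ), ∀ (vs : List ℕ) (r : ℕ), (∀ x ∈ vs, x < r) →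
    ∀ (I : Input) (γ : Γ I) (s : State), HasInput I s → vs.map (s 4) = Ctx.enc I γ →
      f I γ ≤ I.size ^ C ∧ ∃ t s', Runs (P vs r) s t s' ∧ t ≤ I.size ^ C ∧ s' 4 r = f I γ ∧
        Frame r s s'

/-- The predicate `p` of an input and a context is decidable in polynomial time. -/
def Decid {Γ : Input → Type} [Ctx Γ] (p : ∀ I, Γ I → Prop) : Prop :=
  Comp fun I γ => open Classical in if p I γ then 1 else 0

lemma Input.two_le_size (I : Input) : 2 ≤ I.size := by unfold Input.size; omega

lemma Input.size_pow_mono (I : Input) {a b : ℕ} (h : a ≤ b) : I.size ^ a ≤ I.size ^ b :=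
  Nat.pow_le_pow_right (by have := I.two_le_size; omega) h

lemma Input.le_size_pow (I : Input) (a : ℕ) : a ≤ I.size ^ a :=
  (Nat.lt_two_pow_self).le.trans (Nat.pow_le_pow_left I.two_le_size a)

lemma Input.add_le_size_pow (I : Input) {x y a b : ℕ} (hx : x ≤ I.size ^ a) (hy : y ≤ I.size ^ b) :
    x + y ≤ I.size ^ (a + b + 1) := by
  have h1 : x ≤ I.size ^ (a + b) := hx.trans (I.size_pow_mono (by omega))
  have h2 : y ≤ I.size ^ (a + b) := hy.trans (I.size_pow_mono (by omega))
  calc x + y ≤ I.size ^ (a + b) * 2 := by omega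
    _ ≤ I.size ^ (a + b + 1) := by rw [pow_succ]; exact Nat.mul_le_mul_left _ I.two_le_size

lemma Input.mul_le_size_pow (I : Input) {x y a b : ℕ} (hx : x ≤ I.size ^ a) (hy : y ≤ I.size ^ b) :
    x * y ≤ I.size ^ (a + b) := by
  rw [pow_add]; exact Nat.mul_le_mul hx hy

lemma HasInput.n_eq {I : Input} {s : State} (h : HasInput I s) : s 0 0 = I.n := by
  rw [h.1]; simp [inputState]

lemma HasInput.l_eq {I : Input} {s : State} (h : HasInput I s) : s 0 1 = I.l := by
  rw [h.1]; simp [inputState]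

lemma HasInput.k_eq {I : Input} {s : State} (h : HasInput I s) : s 0 2 = I.k := by
  rw [h.1]; simp [inputState]

lemma HasInput.label_eq {I : Input} {s : State} (h : HasInput I s) (u v : Fin I.n) :
    s 1 (u * I.n + v) = (I.φ.label u v).code := by
  have hv := v.isLt
  have hlt : u.val * I.n + v.val < I.n * I.n := by
    have : (u.val + 1) * I.n ≤ I.n * I.n := Nat.mul_le_mul_right _ u.isLt
    nlinarith
  have hn : 0 < I.n := by omega
  rw [h.2]
  simp only [inputState, one_ne_zero, if_false, if_true, dif_pos hlt]
  congr
  · rw [Nat.mul_comm, Nat.mul_add_div hn, Nat.div_eq_of_lt hv, Nat.add_zero]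
  · rw [Nat.mul_comm, Nat.mul_add_mod, Nat.mod_eq_of_lt hv]

lemma Frame.trans {r : ℕ} {s s' s'' : State} (h : Frame r s s') (h' : Frame r s' s'') :
    Frame r s s'' :=
  ⟨fun a ha => (h'.1 a ha).trans (h.1 a ha), fun i hi => (h'.2 i hi).trans (h.2 i hi)⟩

lemma Frame.mono {r r' : ℕ} {s s' : State} (h : Frame r s s') (hr : r' ≤ r) : Frame r' s s' :=
  ⟨h.1, fun i hi => h.2 i (hi.trans_le hr)⟩

lemma Frame.write {r i x : ℕ} (s : State) (hi : r ≤ i) : Frame r s (s.write 4 i x) := by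
  refine ⟨fun a ha => by simp [State.write, ha], fun j hj => ?_⟩
  have : j ≠ i := by omega
  simp [State.write, this]

lemma Frame.hasInput {r : ℕ} {s s' : State} (h : Frame r s s') {I : Input} (hI : HasInput I s) :
    HasInput I s' :=
  ⟨(h.1 0 (by decide)).trans hI.1, (h.1 1 (by decide)).trans hI.2⟩

lemma Frame.map_eq {r : ℕ} {s s' : State} (h : Frame r s s') {vs : List ℕ} (hvs : ∀ x ∈ vs, x < r) :
    vs.map (s' 4) = vs.map (s 4) :=
  List.map_congr_left fun x hx => h.2 x (hvs x hx)

@[simp] lemma State.write_self (s : State) (a i x : ℕ) : s.write a i x a i = x := by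
  simp [State.write]

lemma State.write_ne (s : State) {a i j x : ℕ} (h : j ≠ i) : s.write a i x a j = s a j := by
  simp [State.write, h]

lemma State.write_array_ne (s : State) {a b i x : ℕ} (h : b ≠ a) : s.write a i x b = s b := by
  simp [State.write, h]

/-- Bit lengths are at most the numbers themselves, a crude bound that suffices throughout. -/
lemma size_le_self (x : ℕ) : x.size ≤ x := Nat.size_le.2 Nat.lt_two_pow_self

/-- `m I` is a polynomially bounded number that a loop condition can evaluate. -/
def LoopBound (m : Input → ℕ) : Prop :=
  ∃ (e : Expr) (C : ℕ), ∀ (I : Input) (s : State), HasInput I s →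
    e.eval s = m I ∧ e.cost s ≤ I.size ^ C ∧ m I ≤ I.size ^ C

lemma LoopBound.numVertices : LoopBound Input.n :=
  ⟨.get 0 (.const 0), 2, fun I s hI => ⟨hI.n_eq, I.le_size_pow 2,
    (show I.n ≤ I.size ^ 1 by rw [pow_one]; unfold Input.size; omega).trans
      (I.size_pow_mono (by omega))⟩⟩

lemma LoopBound.numColors : LoopBound Input.l :=
  ⟨.get 0 (.const 1), 2, fun I s hI => ⟨hI.l_eq, I.le_size_pow 2,
    (show I.l ≤ I.size ^ 1 by rw [pow_one]; unfold Input.size; omega).trans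
      (I.size_pow_mono (by omega))⟩⟩

lemma LoopBound.mul {m m' : Input → ℕ} (h : LoopBound m) (h' : LoopBound m') :
    LoopBound fun I => m I * m' I := by
  obtain ⟨e, C, he⟩ := h
  obtain ⟨e', C', he'⟩ := h'
  refine ⟨.mul e e', C + C' + 1 + (C + C' + 1) + 1 + 1 + 1, fun I s hI => ?_⟩
  obtain ⟨h1, h2, h3⟩ := he I s hI
  obtain ⟨h1', h2', h3'⟩ := he' I s hI
  refine ⟨by simp [Expr.eval, h1, h1'], ?_,
    (I.mul_le_size_pow h3 h3').trans (I.size_pow_mono (by omega))⟩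
  have h4 := I.add_le_size_pow (I.add_le_size_pow (I.add_le_size_pow h2 h2')
    (I.add_le_size_pow h3 h3')) (I.le_size_pow 1)
  have h5 := size_le_self (m I)
  have h6 := size_le_self (m' I)
  refine le_trans ?_ (h4.trans (I.size_pow_mono (by omega)))
  simp only [Expr.cost, h1, h1']
  omega

section closure

variable {Γ : Input → Type} [Ctx Γ]

/-- A value that a single expression reads off the memory. -/
lemma Comp.of_expr {f : ∀ I, Γ I → ℕ} (e : List ℕ → Expr) (C : ℕ)
    (h : ∀ vs I γ s, HasInput I s → vs.map (s 4) = Ctx.enc I γ →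
      (e vs).eval s = f I γ ∧ (e vs).cost s ≤ C ∧ f I γ ≤ I.size ^ C) : Comp f := by
  refine ⟨fun vs r => .assign 4 (.const r) (e vs), C + 2, fun vs r hvs I γ s hI hs => ?_⟩
  obtain ⟨h1, h2, h3⟩ := h vs I γ s hI hs
  refine ⟨h3.trans (I.size_pow_mono (by omega)), _, _, Runs.assign _ _ _ _, ?_, ?_,
    Frame.write s le_rfl⟩
  · have := I.le_size_pow (C + 2)
    simp only [Expr.cost]; omega
  · simp [Expr.eval, h1]

lemma Comp.const (x : ℕ) : Comp fun (I : Input) (_ : Γ I) => x :=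
  .of_expr (fun _ => .const x) (x + 1) fun _ I _ _ _ _ =>
    ⟨rfl, by simp [Expr.cost], (I.le_size_pow x).trans (I.size_pow_mono (by omega))⟩

lemma Comp.numVertices : Comp fun (I : Input) (_ : Γ I) => I.n :=
  .of_expr (fun _ => .get 0 (.const 0)) 2 fun _ I _ s hI _ =>
    ⟨hI.n_eq, by simp [Expr.cost], by
      have : I.n ≤ I.size ^ 1 := by rw [pow_one]; unfold Input.size; omega
      exact this.trans (I.size_pow_mono (by omega))⟩

lemma Comp.precision : Comp fun (I : Input) (_ : Γ I) => I.k :=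
  .of_expr (fun _ => .get 0 (.const 2)) 2 fun _ I _ s hI _ =>
    ⟨hI.k_eq, by simp [Expr.cost], by
      have : I.k ≤ I.size ^ 1 := by rw [pow_one]; unfold Input.size; omega
      exact this.trans (I.size_pow_mono (by omega))⟩

lemma Comp.var {m : Input → ℕ} (hm : LoopBound m) :
    Comp fun (I : Input) (p : Γ I × Fin (m I)) => (p.2 : ℕ) := by
  obtain ⟨e, C, he⟩ := hm
  exact .of_expr (fun vs => .get 4 (.const vs.headI)) (C + 2) fun vs I p s hI hs => by
    refine ⟨?_, by simp [Expr.cost],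
      p.2.isLt.le.trans ((he I s hI).2.2.trans (I.size_pow_mono (by omega)))⟩
    cases vs with
    | nil => simp [Ctx.enc] at hs
    | cons a vs =>
      simp only [List.map_cons, Ctx.enc, List.cons.injEq] at hs
      simpa [Expr.eval] using hs.1

lemma Comp.weaken {f : ∀ I, Γ I → ℕ} (hf : Comp f) {m : Input → ℕ} :
    Comp fun (I : Input) (p : Γ I × Fin (m I)) => f I p.1 := by
  obtain ⟨P, C, h⟩ := hf
  refine ⟨fun vs r => P vs.tail r, C, fun vs r hvs I p s hI hs => ?_⟩
  refine h vs.tail r (fun x hx => hvs x (List.mem_of_mem_tail hx)) I p.1 s hI ?_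
  cases vs with
  | nil => simp [Ctx.enc] at hs
  | cons a vs =>
    simp only [List.map_cons, Ctx.enc, List.cons.injEq] at hs
    exact hs.2

/-- Two computed values combined by an expression, which finds them in the cells `r` and `r + 1`. -/
lemma Comp.map₂ {f g h : ∀ I, Γ I → ℕ} (hf : Comp f) (hg : Comp g) (e : ℕ → Expr) (D : ℕ)
    (he : ∀ r I γ s, HasInput I s → s 4 r = f I γ → s 4 (r + 1) = g I γ →
      (e r).eval s = h I γ ∧ (e r).cost s ≤ D * (I.size + f I γ + g I γ) ∧
      h I γ ≤ (I.size + f I γ + g I γ) ^ 2) : Comp h := by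
  obtain ⟨P, C, hP⟩ := hf
  obtain ⟨Q, C', hQ⟩ := hg
  have hb : ∃ B, ∀ I γ, f I γ ≤ I.size ^ C → g I γ ≤ I.size ^ C' →
      D * (I.size + f I γ + g I γ) ≤ I.size ^ B ∧ (I.size + f I γ + g I γ) ^ 2 ≤ I.size ^ B := by
    refine ⟨D + (1 + C + 1 + C' + 1) + (1 + C + 1 + C' + 1) * 2, fun I γ h1 h2 => ?_⟩
    have h3 : I.size ≤ I.size ^ 1 := (pow_one _).ge
    have h4 := I.add_le_size_pow (I.add_le_size_pow h3 h1) h2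
    refine ⟨(I.mul_le_size_pow (I.le_size_pow D) h4).trans (I.size_pow_mono (by omega)), ?_⟩
    refine (Nat.pow_le_pow_left h4 2).trans ?_
    rw [← pow_mul]
    exact I.size_pow_mono (by omega)
  obtain ⟨B, hB⟩ := hb
  refine ⟨fun vs r => .seq (.seq (P vs r) (Q vs (r + 1))) (.assign 4 (.const r) (e r)),
    C + C' + 1 + (B + 2 + 1) + 1, fun vs r hvs I γ s hI hs => ?_⟩
  obtain ⟨h1, t, s', hr, ht, hv, hF⟩ := hP vs r hvs I γ s hI hs
  obtain ⟨h1', t', s'', hr', ht', hv', hF'⟩ := hQ vs (r + 1)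
    (fun x hx => (hvs x hx).trans (Nat.lt_succ_self r)) I γ s' (hF.hasInput hI)
    ((hF.map_eq hvs).trans hs)
  obtain ⟨hB1, hB2⟩ := hB I γ h1 h1'
  obtain ⟨h5, h6, h7⟩ := he r I γ s'' (hF'.hasInput (hF.hasInput hI))
    ((hF'.2 r (Nat.lt_succ_self r)).trans hv) hv'
  refine ⟨(h7.trans hB2).trans (I.size_pow_mono (by omega)), _, _,
    Runs.seq (Runs.seq hr hr') (Runs.assign _ _ _ _), ?_, ?_,
    (hF.trans (hF'.mono (Nat.le_succ r))).trans (Frame.write _ le_rfl)⟩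
  · have h8 : (Expr.const r).cost s'' + (e r).cost s'' + 1 ≤ I.size ^ (B + 2 + 1) := by
      have := I.add_le_size_pow (h6.trans hB1) (I.le_size_pow 2)
      simp only [Expr.cost]; omega
    exact I.add_le_size_pow (I.add_le_size_pow ht ht') h8
  · simp [Expr.eval, h5]

lemma Comp.add {f g : ∀ I, Γ I → ℕ} (hf : Comp f) (hg : Comp g) :
    Comp fun I γ => f I γ + g I γ :=
  hf.map₂ hg (fun r => .add (.get 4 (.const r)) (.get 4 (.const (r + 1)))) 5
    fun r I γ s _ h1 h2 => by
      have := I.two_le_size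
      refine ⟨by simp [Expr.eval, h1, h2], by simp only [Expr.cost]; omega, by nlinarith⟩

lemma Comp.sub {f g : ∀ I, Γ I → ℕ} (hf : Comp f) (hg : Comp g) :
    Comp fun I γ => f I γ - g I γ :=
  hf.map₂ hg (fun r => .sub (.get 4 (.const r)) (.get 4 (.const (r + 1)))) 5
    fun r I γ s _ h1 h2 => by
      have := I.two_le_size
      refine ⟨by simp [Expr.eval, h1, h2], by simp only [Expr.cost]; omega, ?_⟩
      exact (Nat.sub_le _ _).trans (by nlinarith)

lemma Comp.mul {f g : ∀ I, Γ I → ℕ} (hf : Comp f) (hg : Comp g) :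
    Comp fun I γ => f I γ * g I γ :=
  hf.map₂ hg (fun r => .mul (.get 4 (.const r)) (.get 4 (.const (r + 1)))) 5
    fun r I γ s _ h1 h2 => by
      have := I.two_le_size
      refine ⟨by simp [Expr.eval, h1, h2], ?_, by nlinarith⟩
      have h3 := size_le_self (f I γ)
      have h4 := size_le_self (g I γ)
      simp only [Expr.cost, Expr.eval, h1, h2]; omega

lemma Label.code_le {ℓ : ℕ} (x : Label ℓ) : x.code ≤ ℓ := by
  cases x <;> simp [Label.code]

lemma Comp.code {u v : ∀ I : Input, Γ I → Fin I.n} (hu : Comp fun I γ => (u I γ : ℕ))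
    (hv : Comp fun I γ => (v I γ : ℕ)) : Comp fun I γ => (I.φ.label (u I γ) (v I γ)).code :=
  hu.map₂ hv (fun r => .get 1 (.add (.mul (.get 4 (.const r)) (.get 0 (.const 0)))
      (.get 4 (.const (r + 1))))) 10
    fun r I γ s hI h1 h2 => by
      have := I.two_le_size
      refine ⟨?_, ?_, ?_⟩
      · simp only [Expr.eval, h1, h2, hI.n_eq, hI.label_eq]
      · have h3 := size_le_self (u I γ)
        have h4 := size_le_self I.n
        have h5 : I.n ≤ I.size := by unfold Input.size; omega
        simp only [Expr.cost, Expr.eval, h1, hI.n_eq]; omega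
      · have h5 : I.l ≤ I.size := by unfold Input.size; omega
        exact (Label.code_le _).trans (by nlinarith)

/-- A loop that runs a program for the values `0, …, m I - 1` of a counter in the cell `q` and
maintains an invariant. -/
lemma runs_loop {m q T : ℕ} {b : Expr} {P : Program} (Inv : ℕ → State → Prop)
    (hb : ∀ j s, Inv j s → b.eval s = m - j ∧ b.cost s ≤ T)
    (hP : ∀ j s, j < m → Inv j s → ∃ t s', Runs P s t s' ∧ t ≤ T ∧ s' 4 q = j ∧
      Inv (j + 1) (s'.write 4 q (j + 1))) :
    ∀ (d j : ℕ) (s : State), j + d = m → Inv j s → ∃ t s',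
      Runs (.while b (.seq P (.assign 4 (.const q) (.add (.get 4 (.const q)) (.const 1))))) s t s' ∧
      t ≤ (d + 1) * (2 * T + 7) ∧ Inv m s' := by
  intro d
  induction d with
  | zero =>
    intro j s hj hs
    obtain rfl : j = m := by omega
    obtain ⟨h1, h2⟩ := hb j s hs
    exact ⟨_, s, Runs.while_false (by omega), by omega, hs⟩
  | succ d ih =>
    intro j s hj hs
    obtain ⟨h1, h2⟩ := hb j s hs
    obtain ⟨t, s', hr, ht, hq, hs'⟩ := hP j s (by omega) hs
    obtain ⟨t', s'', hr', ht', hs''⟩ := ih (j + 1) _ (by omega) hs'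
    have ha := Runs.assign s' 4 (.const q) (.add (.get 4 (.const q)) (.const 1))
    simp only [Expr.eval, Expr.cost, hq] at ha
    refine ⟨_, s'', Runs.while_true (by omega) (Runs.seq hr ha) hr', ?_, hs''⟩
    have : (d + 1 + 1) * (2 * T + 7) = (d + 1) * (2 * T + 7) + (2 * T + 7) := by ring
    omega

/-- The value after `j` rounds of a summation loop. -/
lemma sum_range_dite_succ {m j : ℕ} (hj : j < m) (f : Fin m → ℕ) :
    (∑ i ∈ Finset.range (j + 1), if h : i < m then f ⟨i, h⟩ else 0) =
      (∑ i ∈ Finset.range j, if h : i < m then f ⟨i, h⟩ else 0) + f ⟨j, hj⟩ := by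
  rw [Finset.sum_range_succ, dif_pos hj]

/-- A bounded sum: the accumulator is in the cell `r`, the counter in the cell `r + 1`, and the
summand is computed from the cell `r + 2` on. -/
lemma Comp.sum {m : Input → ℕ} (hm : LoopBound m) {f : ∀ I, Γ I → Fin (m I) → ℕ}
    (hf : Comp fun (I : Input) (p : Γ I × Fin (m I)) => f I p.1 p.2) :
    Comp fun I γ => ∑ j : Fin (m I), f I γ j := by
  obtain ⟨e, D, he⟩ := hm
  obtain ⟨P, C, hP⟩ := hf
  refine ⟨fun vs r => .seq (.assign 4 (.const r) (.const 0)) (.seq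
      (.assign 4 (.const (r + 1)) (.const 0))
      (.while (.sub e (.get 4 (.const (r + 1)))) (.seq
        (.seq (P ((r + 1) :: vs) (r + 2))
          (.assign 4 (.const r) (.add (.get 4 (.const r)) (.get 4 (.const (r + 2))))))
        (.assign 4 (.const (r + 1)) (.add (.get 4 (.const (r + 1))) (.const 1)))))),
    D + 1 + 1 + (1 + (D + C + 1 + 10) + 7 + 1) + 6 + 1, fun vs r hvs I γ s hI hs => ?_⟩
  obtain ⟨-, -, hmD⟩ := he I s hI
  have hle : ∀ j : Fin (m I), f I γ j ≤ I.size ^ C := by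
    intro j
    -- the bound on the summand is read off in a state that represents the longer context
    refine (hP ((r + 1) :: vs) (r + 2) ?_ I (γ, j) (s.write 4 (r + 1) j)
      ((Frame.write (r := r) s (Nat.le_succ r)).hasInput hI) ?_).1
    · simp only [List.mem_cons, forall_eq_or_imp]
      exact ⟨by omega, fun x hx => by have := hvs x hx; omega⟩
    · rw [List.map_cons, (Frame.write (r := r) s (Nat.le_succ r)).map_eq hvs, hs]
      simp [Ctx.enc]
  refine ⟨?_, ?_⟩
  · calc ∑ j : Fin (m I), f I γ j ≤ ∑ _j : Fin (m I), I.size ^ C :=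
        Finset.sum_le_sum fun j _ => hle j
      _ = m I * I.size ^ C := by simp
      _ ≤ I.size ^ (D + C) := I.mul_le_size_pow hmD le_rfl
      _ ≤ _ := I.size_pow_mono (by omega)
  set s₁ := (s.write 4 r 0).write 4 (r + 1) 0 with hs₁
  let Inv : ℕ → State → Prop := fun j s' => Frame r s s' ∧ s' 4 (r + 1) = j ∧
    s' 4 r = ∑ i ∈ Finset.range j, if h : i < m I then f I γ ⟨i, h⟩ else 0
  have h₁ : Inv 0 s₁ := by
    refine ⟨(Frame.write s le_rfl).trans (Frame.write _ (Nat.le_succ r)), by simp [hs₁], ?_⟩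
    rw [hs₁, State.write_ne _ (by omega)]
    simp
  obtain ⟨t, s', hr, ht, hF, -, hv⟩ := runs_loop (m := m I) (q := r + 1)
    (T := I.size ^ (D + C + 1 + 10)) (b := .sub e (.get 4 (.const (r + 1))))
    (P := .seq (P ((r + 1) :: vs) (r + 2))
      (.assign 4 (.const r) (.add (.get 4 (.const r)) (.get 4 (.const (r + 2)))))) Inv
    (by
      rintro j s' ⟨hF, hj, -⟩
      obtain ⟨h1, h2, -⟩ := he I s' (hF.hasInput hI)
      refine ⟨by simp [Expr.eval, h1, hj], ?_⟩
      have := (I.add_le_size_pow h2 (I.le_size_pow 3)).trans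
        (I.size_pow_mono (show D + 3 + 1 ≤ D + C + 1 + 10 by omega))
      simp only [Expr.cost]; omega)
    (by
      rintro j s' hj ⟨hF, hjr, hacc⟩
      obtain ⟨-, t, s'', hr, ht, hv, hF'⟩ := hP ((r + 1) :: vs) (r + 2) (by
          simp only [List.mem_cons, forall_eq_or_imp]
          exact ⟨by omega, fun x hx => by have := hvs x hx; omega⟩) I (γ, ⟨j, hj⟩) s'
        (hF.hasInput hI) (by rw [List.map_cons, hF.map_eq hvs, hs, hjr]; rfl)
      refine ⟨_, _, Runs.seq hr (Runs.assign _ _ _ _), ?_, ?_, ?_, by simp, ?_⟩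
      · have := (I.add_le_size_pow ht (I.le_size_pow 10)).trans
          (I.size_pow_mono (show C + 10 + 1 ≤ D + C + 1 + 10 by omega))
        simp only [Expr.cost]; omega
      · simp only [Expr.eval]
        rw [State.write_ne _ (by omega), hF'.2 _ (by omega), hjr]
      · exact ((hF.trans (hF'.mono (by omega))).trans (Frame.write _ le_rfl)).trans
          (Frame.write _ (Nat.le_succ r))
      · rw [State.write_ne _ (by omega), sum_range_dite_succ hj, ← hacc]
        simp [Expr.eval, hv, hF'.2 r (by omega)])
    (m I) 0 s₁ (by omega) h₁
  refine ⟨_, s', Runs.seq (Runs.assign s 4 (.const r) (.const 0))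
    (Runs.seq (Runs.assign _ 4 (.const (r + 1)) (.const 0)) hr), ?_, ?_, hF⟩
  · have h2 := I.mul_le_size_pow (show 2 ≤ I.size ^ 1 by rw [pow_one]; exact I.two_le_size)
      (le_refl (I.size ^ (D + C + 1 + 10)))
    have h3 := I.mul_le_size_pow (I.add_le_size_pow hmD (I.le_size_pow 1))
      (I.add_le_size_pow h2 (I.le_size_pow 7))
    have h4 := I.add_le_size_pow (ht.trans h3) (I.le_size_pow 6)
    simp only [Expr.cost]
    refine le_trans (by omega) (h4.trans (I.size_pow_mono ?_))
    omega
  · exact hv.trans (Finset.sum_fin_eq_sum_range _).symm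

lemma Comp.ite {p : ∀ I, Γ I → Prop} [∀ I γ, Decidable (p I γ)] {f : ∀ I, Γ I → ℕ}
    (hp : Decid p) (hf : Comp f) : Comp fun I γ => if p I γ then f I γ else 0 := by
  convert hp.mul hf using 3 with I γ
  split_ifs <;> simp

lemma Decid.le {f g : ∀ I, Γ I → ℕ} (hf : Comp f) (hg : Comp g) :
    Decid fun I γ => f I γ ≤ g I γ := by
  unfold Decid
  convert (Comp.const 1).sub (hf.sub hg) using 3 with I γ
  split_ifs <;> omega

lemma Decid.lt {f g : ∀ I, Γ I → ℕ} (hf : Comp f) (hg : Comp g) :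
    Decid fun I γ => f I γ < g I γ :=
  Decid.le (hf.add (.const 1)) hg

lemma Decid.not {p : ∀ I, Γ I → Prop} (hp : Decid p) : Decid fun I γ => ¬ p I γ := by
  unfold Decid
  convert (Comp.const 1).sub hp using 3 with I γ
  by_cases h : p I γ <;> simp [h]

lemma Decid.and {p q : ∀ I, Γ I → Prop} (hp : Decid p) (hq : Decid q) :
    Decid fun I γ => p I γ ∧ q I γ := by
  unfold Decid
  convert hp.mul hq using 3 with I γ
  by_cases h : p I γ <;> by_cases h' : q I γ <;> simp [h, h']

lemma Decid.or {p q : ∀ I, Γ I → Prop} (hp : Decid p) (hq : Decid q) :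
    Decid fun I γ => p I γ ∨ q I γ := by
  convert (hp.not.and hq.not).not using 3
  tauto

lemma Decid.imp {p q : ∀ I, Γ I → Prop} (hp : Decid p) (hq : Decid q) :
    Decid fun I γ => p I γ → q I γ := by
  convert hp.not.or hq using 3
  tauto

lemma Decid.eq {f g : ∀ I, Γ I → ℕ} (hf : Comp f) (hg : Comp g) :
    Decid fun I γ => f I γ = g I γ := by
  convert (Decid.le hf hg).and (Decid.le hg hf) using 3
  exact le_antisymm_iff

/-- A bounded existential quantifier is a bounded sum that is positive. -/
lemma Decid.exists {m : Input → ℕ} (hm : LoopBound m) {p : ∀ I, Γ I → Fin (m I) → Prop}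
    (hp : Decid fun (I : Input) (q : Γ I × Fin (m I)) => p I q.1 q.2) :
    Decid fun I γ => ∃ j, p I γ j := by
  convert Decid.lt (.const 0) (Comp.sum hm (f := fun I γ j => open Classical in
    if p I γ j then 1 else 0) hp) using 3 with I γ
  simp [Finset.card_pos, Finset.filter_nonempty_iff]

lemma Decid.forall {m : Input → ℕ} (hm : LoopBound m) {p : ∀ I, Γ I → Fin (m I) → Prop}
    (hp : Decid fun (I : Input) (q : Γ I × Fin (m I)) => p I q.1 q.2) :
    Decid fun I γ => ∀ j, p I γ j := by
  convert (Decid.exists hm (p := fun I γ j => ¬ p I γ j) hp.not).not using 3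
  simp

lemma Comp.card_filter {m : Input → ℕ} (hm : LoopBound m) {p : ∀ I, Γ I → Fin (m I) → Prop}
    [∀ I γ j, Decidable (p I γ j)]
    (hp : Decid fun (I : Input) (q : Γ I × Fin (m I)) => p I q.1 q.2) :
    Comp fun I γ => (Finset.univ.filter fun j => p I γ j).card := by
  classical
  have h := Comp.sum hm (f := fun I γ j => if p I γ j then 1 else 0) (by
    unfold Decid at hp; convert hp)
  simpa only [Finset.card_filter] using h

/-- Division of `n` is done by counting the multiples of the divisor up to `n`. -/
lemma Comp.numVertices_div {f : ∀ I, Γ I → ℕ} (hf : Comp f) :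
    Comp fun I γ => I.n / f I γ := by
  classical
  convert Comp.ite (Decid.lt (.const 0) hf) (Comp.card_filter .numVertices
    (p := fun I γ j => ((j : ℕ) + 1) * f I γ ≤ I.n)
    (Decid.le (((Comp.var .numVertices).add (.const 1)).mul hf.weaken) .numVertices)) using 3 with I γ
  split_ifs with h
  · have h3 : (Finset.univ.filter fun j : Fin I.n => (j : ℕ) < I.n / f I γ).card = I.n / f I γ := by
      rw [Fin.card_filter_val_lt]
      exact min_eq_right (Nat.div_le_self _ _)
    refine h3.symm.trans (congrArg Finset.card ?_)
    ext j
    simp only [Finset.mem_filter, Finset.mem_univ, true_and]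
    rw [← Nat.le_div_iff_mul_le h, Nat.succ_le_iff]
  · rw [Nat.eq_zero_of_not_pos h, Nat.div_zero]

end closure

/-- A computable function can be written into the array `a`, for all indices up to a bound. -/
lemma Comp.exists_fill {m : Input → ℕ} (hm : LoopBound m) {f : ∀ I : Input, Fin (m I) → ℕ}
    (hf : Comp fun (I : Input) (p : Unit × Fin (m I)) => f I p.2) (a : ℕ) (h0 : a ≠ 0) (h1 : a ≠ 1)
    (h4 : a ≠ 4) :
    ∃ (P : Program) (C : ℕ), ∀ (I : Input) (s : State), HasInput I s →
      ∃ t s', Runs P s t s' ∧ t ≤ I.size ^ C ∧ (∀ i : Fin (m I), s' a i = f I i) ∧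
        ∀ b, b ≠ 4 → b ≠ a → s' b = s b := by
  obtain ⟨e, D, he⟩ := hm
  obtain ⟨P, C, hP⟩ := hf
  refine ⟨.seq (.assign 4 (.const 0) (.const 0))
      (.while (.sub e (.get 4 (.const 0))) (.seq
        (.seq (P [0] 1) (.assign a (.get 4 (.const 0)) (.get 4 (.const 1))))
        (.assign 4 (.const 0) (.add (.get 4 (.const 0)) (.const 1))))),
    D + 1 + 1 + (1 + (D + C + 1 + 10) + 7 + 1) + 3 + 1, fun I s hI => ?_⟩
  obtain ⟨-, -, hmD⟩ := he I s hI
  let Inv : ℕ → State → Prop := fun j s' => (∀ b, b ≠ 4 → b ≠ a → s' b = s b) ∧ s' 4 0 = j ∧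
    ∀ i : Fin (m I), i < j → s' a i = f I i
  have hin : ∀ j s', Inv j s' → HasInput I s' := fun j s' h =>
    ⟨(h.1 0 (by decide) h0.symm).trans hI.1, (h.1 1 (by decide) h1.symm).trans hI.2⟩
  have hI0 : Inv 0 (s.write 4 0 0) :=
    ⟨fun b hb _ => State.write_array_ne _ hb, by simp, fun i hi => absurd hi (by simp)⟩
  obtain ⟨t, s', hr, ht, hF, -, hv⟩ := runs_loop (m := m I) (q := 0)
    (T := I.size ^ (D + C + 1 + 10)) (b := .sub e (.get 4 (.const 0)))
    (P := .seq (P [0] 1) (.assign a (.get 4 (.const 0)) (.get 4 (.const 1)))) Inv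
    (by
      rintro j s' hj
      obtain ⟨h2, h3, -⟩ := he I s' (hin j s' hj)
      refine ⟨by simp [Expr.eval, h2, hj.2.1], ?_⟩
      have := (I.add_le_size_pow h3 (I.le_size_pow 3)).trans
        (I.size_pow_mono (show D + 3 + 1 ≤ D + C + 1 + 10 by omega))
      simp only [Expr.cost]; omega)
    (by
      rintro j s' hj hs'
      obtain ⟨-, t, s'', hr, ht, hv, hF'⟩ := hP [0] 1 (by simp) I ((), ⟨j, hj⟩) s' (hin j s' hs')
        (by simp [Ctx.enc, hs'.2.1])
      have hq : s'' 4 0 = j := (hF'.2 0 (by omega)).trans hs'.2.1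
      refine ⟨_, _, Runs.seq hr (Runs.assign _ _ _ _), ?_, ?_, ?_, by simp, ?_⟩
      · have := (I.add_le_size_pow ht (I.le_size_pow 10)).trans
          (I.size_pow_mono (show C + 10 + 1 ≤ D + C + 1 + 10 by omega))
        simp only [Expr.cost]; omega
      · rw [State.write_array_ne _ h4.symm, hq]
      · intro b hb hb'
        rw [State.write_array_ne _ hb, State.write_array_ne _ hb', hF'.1 b hb]
        exact hs'.1 b hb hb'
      · intro i hi
        rw [State.write_array_ne _ h4]
        simp only [Expr.eval, hq, hv]
        rcases eq_or_ne i ⟨j, hj⟩ with rfl | hij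
        · simp
        · have hne : (i : ℕ) ≠ j := fun h => hij (Fin.ext h)
          rw [State.write_ne _ hne, hF'.1 a h4]
          exact hs'.2.2 i (by omega))
    (m I) 0 _ (by omega) hI0
  refine ⟨_, s', Runs.seq (Runs.assign s 4 (.const 0) (.const 0)) hr, ?_,
    fun i => hv i i.isLt, hF⟩
  have h2 := I.mul_le_size_pow (show 2 ≤ I.size ^ 1 by rw [pow_one]; exact I.two_le_size)
    (le_refl (I.size ^ (D + C + 1 + 10)))
  have h3 := I.mul_le_size_pow (I.add_le_size_pow hmD (I.le_size_pow 1))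
    (I.add_le_size_pow h2 (I.le_size_pow 7))
  have h5 := I.add_le_size_pow (ht.trans h3) (I.le_size_pow 3)
  simp only [Expr.cost]
  refine le_trans (by omega) (h5.trans (I.size_pow_mono ?_))
  omega

open Finset

/-! ### Rows of the instance as points of a Hamming space -/

section atoms

variable {n ℓ : ℕ} (φ : EdgeColoring n ℓ)

/-- The labels at the vertex `v`, as numbers, where `v` is regarded as joined to itself in the
colour `c`. -/
def EdgeColoring.row (v : Fin n) (c : Fin ℓ) : Fin n → ℕ :=
  fun x => if x = v then c + 1 else (φ.label v x).code

/-- The row that every vertex of a perfect cluster `S` of colour `c` would have. -/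
def ind (S : Finset (Fin n)) (c : Fin ℓ) : Fin n → ℕ :=
  fun x => if x ∈ S then c + 1 else 0

/-- The number of disagreements of `v` with the cluster `S` of colour `c`; a vertex outside of `S`
disagrees with it also at `v` itself. -/
def EdgeColoring.dis (v : Fin n) (S : Finset (Fin n)) (c : Fin ℓ) : ℕ :=
  hammingDist (φ.row v c) (ind S c)

/-- The closed neighbourhood of `u` in the colour `c`. -/
def EdgeColoring.nb (u : Fin n) (c : Fin ℓ) : Finset (Fin n) :=
  univ.filter fun x => φ.row u c x = c + 1

/-- `x` almost agrees with the cluster formed by the closed neighbourhood of `u` in colour `c`. -/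
def EdgeColoring.IsCore (u : Fin n) (c : Fin ℓ) (x : Fin n) : Prop :=
  300 * φ.dis x (φ.nb u c) c ≤ (φ.nb u c).card

open Classical in
/-- The closed neighbourhood of `u` in colour `c` is nearly a perfect cluster around `u`: the vertex
`u` and all but a small fraction of the vertices are core vertices. -/
def EdgeColoring.IsTight (u : Fin n) (c : Fin ℓ) : Prop :=
  2 ≤ (φ.nb u c).card ∧ φ.IsCore u c u ∧
    300 * ((φ.nb u c).filter fun x => ¬ φ.IsCore u c x).card ≤ (φ.nb u c).card

/-- All vertices that agree well, though perhaps less well than the core vertices, with the cluster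
formed by the closed neighbourhood of `u`. -/
def EdgeColoring.hull (u : Fin n) (c : Fin ℓ) : Finset (Fin n) :=
  univ.filter fun v => 30 * φ.dis v (φ.nb u c) c ≤ (φ.nb u c).card

/-- `(u, c)` is the first of the tight pairs whose hulls meet its own. The hulls of these pairs are
the atoms of the preclustering. -/
def EdgeColoring.IsRep (u : Fin n) (c : Fin ℓ) : Prop :=
  φ.IsTight u c ∧ ∀ u' c', u' < u → φ.IsTight u' c' → Disjoint (φ.hull u c) (φ.hull u' c')

variable {φ}

lemma card_sdiff_le_hammingDist (S T : Finset (Fin n)) (c c' : Fin ℓ) :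
    (S \ T).card ≤ hammingDist (ind S c) (ind T c') := by
  refine card_le_card fun x hx => ?_
  rw [mem_sdiff] at hx
  refine mem_filter.2 ⟨mem_univ x, ?_⟩
  simp [ind, hx.1, hx.2]

lemma card_le_card_add_hammingDist (S T : Finset (Fin n)) (c c' : Fin ℓ) :
    S.card ≤ T.card + hammingDist (ind S c) (ind T c') := by
  have h1 := card_sdiff_le_hammingDist S T c c'
  have h2 := le_card_sdiff T S
  omega

lemma card_le_hammingDist_of_ne (S T : Finset (Fin n)) {c c' : Fin ℓ} (h : c ≠ c') :
    S.card ≤ hammingDist (ind S c) (ind T c') := by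
  refine card_le_card fun x hx => ?_
  have h' : (c : ℕ) ≠ c' := fun e => h (Fin.ext e)
  refine mem_filter.2 ⟨mem_univ x, ?_⟩
  simp only [ind, hx, if_true]
  split_ifs <;> omega

lemma hammingDist_row_le (v : Fin n) (c c' : Fin ℓ) :
    hammingDist (φ.row v c) (φ.row v c') ≤ 1 := by
  refine (card_le_card (t := {v}) fun x hx => ?_).trans (card_singleton v).le
  by_contra h
  rw [mem_singleton] at h
  exact (mem_filter.1 hx).2 (by simp [EdgeColoring.row, h])

lemma dis_le_dis_add (v : Fin n) (S T : Finset (Fin n)) (c : Fin ℓ) :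
    φ.dis v S c ≤ φ.dis v T c + hammingDist (ind T c) (ind S c) :=
  hammingDist_triangle _ _ _

lemma hammingDist_ind_le (v : Fin n) (S T : Finset (Fin n)) (c : Fin ℓ) :
    hammingDist (ind S c) (ind T c) ≤ φ.dis v S c + φ.dis v T c := by
  unfold EdgeColoring.dis
  rw [hammingDist_comm (φ.row v c) (ind S c)]
  exact hammingDist_triangle _ _ _

/-- The sets enter only through their symmetric difference. -/
lemma hammingDist_ind_eq (S T : Finset (Fin n)) (c : Fin ℓ) :
    hammingDist (ind S c) (ind T c) = (S \ T).card + (T \ S).card := by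
  rw [← card_union_of_disjoint (disjoint_sdiff_sdiff)]
  refine congrArg card ?_
  ext x
  refine mem_filter.trans ?_
  by_cases h : x ∈ S <;> by_cases h' : x ∈ T <;> simp [ind, h, h']

/-! ### Tight neighbourhoods and their hulls -/

lemma mem_hull {u v : Fin n} {c : Fin ℓ} :
    v ∈ φ.hull u c ↔ 30 * φ.dis v (φ.nb u c) c ≤ (φ.nb u c).card := by
  simp [EdgeColoring.hull]

lemma EdgeColoring.IsCore.mem_hull {u x : Fin n} {c : Fin ℓ} (h : φ.IsCore u c x) :
    x ∈ φ.hull u c := by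
  unfold EdgeColoring.IsCore at h
  rw [CCC.mem_hull]; omega

/-- A first, weak estimate for tight neighbourhoods whose hulls meet. -/
lemma eq_and_hammingDist_le_of_mem_hull {u u' v : Fin n} {c c' : Fin ℓ}
    (h2 : 2 ≤ (φ.nb u c).card) (hv : v ∈ φ.hull u c) (hv' : v ∈ φ.hull u' c') :
    c = c' ∧ 30 * hammingDist (ind (φ.nb u c) c) (ind (φ.nb u' c') c') ≤
      (φ.nb u c).card + (φ.nb u' c').card := by
  rw [mem_hull] at hv hv'
  have hc : c = c' := by
    by_contra hc
    have h3 := card_le_hammingDist_of_ne (φ.nb u c) (φ.nb u' c') hc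
    have h4 := card_le_hammingDist_of_ne (φ.nb u' c') (φ.nb u c) (Ne.symm hc)
    rw [hammingDist_comm] at h4
    have h5 := hammingDist_triangle (ind (φ.nb u c) c) (φ.row v c) (ind (φ.nb u' c') c')
    have h6 := hammingDist_triangle (φ.row v c) (φ.row v c') (ind (φ.nb u' c') c')
    have h7 := hammingDist_row_le (φ := φ) v c c'
    rw [hammingDist_comm (ind (φ.nb u c) c) (φ.row v c)] at h5
    unfold EdgeColoring.dis at hv hv'
    omega
  subst hc
  refine ⟨rfl, ?_⟩
  have := hammingDist_ind_le (φ := φ) v (φ.nb u c) (φ.nb u' c) c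
  omega

/-- Tight neighbourhoods whose hulls meet are even closer to each other than the definition of the
hull suggests, because they have a common core vertex. -/
lemma EdgeColoring.IsTight.close {u u' v : Fin n} {c c' : Fin ℓ} (h : φ.IsTight u c)
    (h' : φ.IsTight u' c') (hv : v ∈ φ.hull u c) (hv' : v ∈ φ.hull u' c') :
    c = c' ∧ 300 * hammingDist (ind (φ.nb u c) c) (ind (φ.nb u' c') c') ≤
      (φ.nb u c).card + (φ.nb u' c').card := by
  classical
  obtain ⟨rfl, hd⟩ := eq_and_hammingDist_le_of_mem_hull h.1 hv hv'
  refine ⟨rfl, ?_⟩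
  obtain ⟨x, hx, hx'⟩ : ∃ x, φ.IsCore u c x ∧ φ.IsCore u' c x := by
    by_contra! hne
    have h1 : φ.nb u c ⊆ (φ.nb u c \ φ.nb u' c) ∪
        (((φ.nb u c).filter fun x => ¬ φ.IsCore u c x) ∪
          ((φ.nb u' c).filter fun x => ¬ φ.IsCore u' c x)) := by
      intro x hx
      simp only [mem_union, mem_sdiff, mem_filter, hx, true_and]
      have := hne x
      tauto
    have h2 := (card_le_card h1).trans (card_union_le _ _)
    have h3 := card_union_le ((φ.nb u c).filter fun x => ¬ φ.IsCore u c x)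
      ((φ.nb u' c).filter fun x => ¬ φ.IsCore u' c x)
    have h4 := card_sdiff_le_hammingDist (φ.nb u c) (φ.nb u' c) c c
    have h5 := card_le_card_add_hammingDist (φ.nb u' c) (φ.nb u c) c c
    rw [hammingDist_comm] at h5
    have h6 := h.2.2
    have h7 := h'.2.2
    have h8 := h.1
    omega
  have := hammingDist_ind_le (φ := φ) x (φ.nb u c) (φ.nb u' c) c
  unfold EdgeColoring.IsCore at hx hx'
  omega

/-- Among tight neighbourhoods, having hulls that meet is transitive. -/
lemma EdgeColoring.IsTight.not_disjoint_trans {u₁ u₂ u₃ : Fin n} {c₁ c₂ c₃ : Fin ℓ}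
    (h₁ : φ.IsTight u₁ c₁) (h₂ : φ.IsTight u₂ c₂) (h₃ : φ.IsTight u₃ c₃)
    (h₁₂ : ¬ Disjoint (φ.hull u₁ c₁) (φ.hull u₂ c₂))
    (h₂₃ : ¬ Disjoint (φ.hull u₂ c₂) (φ.hull u₃ c₃)) :
    ¬ Disjoint (φ.hull u₁ c₁) (φ.hull u₃ c₃) := by
  rw [not_disjoint_iff] at *
  obtain ⟨v, hv, hv'⟩ := h₁₂
  obtain ⟨w, hw, hw'⟩ := h₂₃
  obtain ⟨rfl, h4⟩ := h₁.close h₂ hv hv'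
  obtain ⟨rfl, h5⟩ := h₂.close h₃ hw hw'
  refine ⟨u₁, h₁.2.1.mem_hull, ?_⟩
  rw [mem_hull]
  have h6 := h₁.2.1
  unfold EdgeColoring.IsCore at h6
  have h7 := dis_le_dis_add (φ := φ) u₁ (φ.nb u₃ c₁) (φ.nb u₁ c₁) c₁
  have h8 := hammingDist_triangle (ind (φ.nb u₁ c₁) c₁) (ind (φ.nb u₂ c₁) c₁) (ind (φ.nb u₃ c₁) c₁)
  have h9 := card_le_card_add_hammingDist (φ.nb u₁ c₁) (φ.nb u₂ c₁) c₁ c₁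
  have h10 := card_le_card_add_hammingDist (φ.nb u₂ c₁) (φ.nb u₃ c₁) c₁ c₁
  omega

lemma EdgeColoring.IsTight.exists_isRep {u : Fin n} {c : Fin ℓ} (h : φ.IsTight u c) :
    ∃ r c', φ.IsRep r c' ∧ ¬ Disjoint (φ.hull r c') (φ.hull u c) := by
  classical
  have hne : (univ.filter fun r => ∃ c', φ.IsTight r c' ∧
      ¬ Disjoint (φ.hull r c') (φ.hull u c)).Nonempty :=
    ⟨u, by
      simp only [mem_filter, mem_univ, true_and]
      exact ⟨c, h, not_disjoint_iff.2 ⟨u, h.2.1.mem_hull, h.2.1.mem_hull⟩⟩⟩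
  obtain ⟨r, hr, hmin⟩ := exists_min_image _ id hne
  simp only [mem_filter, mem_univ, true_and] at hr hmin
  obtain ⟨c', hr, hru⟩ := hr
  refine ⟨r, c', ⟨hr, fun u' c'' hlt hu' => ?_⟩, hru⟩
  by_contra hd
  rw [disjoint_comm] at hd
  exact absurd (hmin u' ⟨c'', hu', hu'.not_disjoint_trans hr h hd hru⟩) (not_le.2 hlt)

/-- The hulls of different representatives are disjoint. -/
lemma EdgeColoring.IsRep.eq_of_mem_hull {r r' v : Fin n} {c c' : Fin ℓ} (h : φ.IsRep r c)
    (h' : φ.IsRep r' c') (hv : v ∈ φ.hull r c) (hv' : v ∈ φ.hull r' c') : r = r' ∧ c = c' := by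
  refine ⟨?_, (h.1.close h'.1 hv hv').1⟩
  rcases lt_trichotomy r r' with hlt | heq | hlt
  · exact absurd (h'.2 r c hlt h.1) (not_disjoint_iff.2 ⟨v, hv', hv⟩)
  · exact heq
  · exact absurd (h.2 r' c' hlt h'.1) (not_disjoint_iff.2 ⟨v, hv, hv'⟩)

/-- The colour `c` as seen from one end of a pair and from the other. -/
lemma mem_nb_comm {u v : Fin n} {c : Fin ℓ} : v ∈ φ.nb u c ↔ u ∈ φ.nb v c := by
  simp only [EdgeColoring.nb, mem_filter, mem_univ, true_and]
  simp only [EdgeColoring.row, φ.symm u v, eq_comm (a := u) (b := v)]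

lemma card_nb_sdiff_le_dis (v : Fin n) (S : Finset (Fin n)) (c : Fin ℓ) :
    (φ.nb v c \ S).card ≤ φ.dis v S c := by
  unfold EdgeColoring.dis hammingDist
  refine card_le_card fun x hx => ?_
  simp only [mem_sdiff, EdgeColoring.nb, mem_filter, mem_univ, true_and] at hx
  refine mem_filter.2 ⟨mem_univ x, ?_⟩
  simp [ind, hx.1, hx.2]

lemma card_sdiff_nb_le_dis (v : Fin n) (S : Finset (Fin n)) (c : Fin ℓ) :
    (S \ φ.nb v c).card ≤ φ.dis v S c := by
  unfold EdgeColoring.dis hammingDist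
  refine card_le_card fun x hx => ?_
  simp only [mem_sdiff, EdgeColoring.nb, mem_filter, mem_univ, true_and] at hx
  refine mem_filter.2 ⟨mem_univ x, ?_⟩
  simp [ind, hx.1, hx.2]

/-- Few vertices are added in the passage from a tight neighbourhood to its hull: each of them sends
edges of colour `c` to most core vertices, which have few such edges going out. -/
lemma EdgeColoring.IsTight.card_hull_sdiff_le {u : Fin n} {c : Fin ℓ} (h : φ.IsTight u c) :
    200 * (φ.hull u c \ φ.nb u c).card ≤ (φ.nb u c).card := by
  classical
  set S := φ.nb u c with hS
  set K := S.filter fun x => φ.IsCore u c x with hK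
  have hKc : 300 * S.card ≤ 300 * K.card + S.card := by
    have h1 := h.2.2
    have h2 := card_filter_add_card_filter_not (s := S) (fun x => φ.IsCore u c x)
    rw [← hS] at h1
    rw [← hK] at h2
    omega
  have h1 : ∀ v ∈ φ.hull u c \ S, 28 * S.card ≤ 30 * (K.filter fun x => x ∈ φ.nb v c).card := by
    intro v hv
    rw [mem_sdiff, CCC.mem_hull, ← hS] at hv
    have h2 := card_sdiff_nb_le_dis (φ := φ) v S c
    have h3 : (K.filter fun x => ¬ x ∈ φ.nb v c).card ≤ (S \ φ.nb v c).card :=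
      card_le_card fun x hx => by
        simp only [hK, mem_filter] at hx
        exact mem_sdiff.2 ⟨hx.1.1, hx.2⟩
    have h4 := card_filter_add_card_filter_not (s := K) (fun x => x ∈ φ.nb v c)
    omega
  have h2 : ∀ x ∈ K, 300 * ((φ.hull u c \ S).filter fun v => x ∈ φ.nb v c).card ≤ S.card := by
    intro x hx
    have h3 : φ.IsCore u c x := (mem_filter.1 hx).2
    unfold EdgeColoring.IsCore at h3
    have h4 := card_nb_sdiff_le_dis (φ := φ) x S c
    have h5 : ((φ.hull u c \ S).filter fun v => x ∈ φ.nb v c).card ≤ (φ.nb x c \ S).card :=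
      card_le_card fun v hv => by
        simp only [mem_filter, mem_sdiff] at hv
        exact mem_sdiff.2 ⟨mem_nb_comm.1 hv.2, hv.1.2⟩
    rw [← hS] at h3
    omega
  have h3 : ∑ v ∈ φ.hull u c \ S, (K.filter fun x => x ∈ φ.nb v c).card =
      ∑ x ∈ K, ((φ.hull u c \ S).filter fun v => x ∈ φ.nb v c).card :=
    sum_card_bipartiteAbove_eq_sum_card_bipartiteBelow _
  have h4 : (φ.hull u c \ S).card * (28 * S.card) ≤
      30 * ∑ v ∈ φ.hull u c \ S, (K.filter fun x => x ∈ φ.nb v c).card := by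
    rw [mul_sum, ← smul_eq_mul]
    exact card_nsmul_le_sum _ _ _ h1
  have h5 : 300 * ∑ x ∈ K, ((φ.hull u c \ S).filter fun v => x ∈ φ.nb v c).card ≤
      K.card * S.card := by
    rw [mul_sum, ← smul_eq_mul]
    exact sum_le_card_nsmul _ _ _ h2
  have h6 : K.card ≤ S.card := card_le_card (filter_subset _ _)
  have h7 : 0 < S.card := lt_of_lt_of_le two_pos h.1
  have h8 : (φ.hull u c \ S).card * (28 * S.card) * 10 ≤ S.card * S.card := by
    have := Nat.mul_le_mul_right S.card h6
    omega
  have h9 : ((φ.hull u c \ S).card * 280) * S.card ≤ S.card * S.card := by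
    calc _ = (φ.hull u c \ S).card * (28 * S.card) * 10 := by ring
      _ ≤ _ := h8
  have := Nat.le_of_mul_le_mul_right h9 h7
  omega

lemma EdgeColoring.IsTight.card_sdiff_hull_le {u : Fin n} {c : Fin ℓ} (h : φ.IsTight u c) :
    300 * (φ.nb u c \ φ.hull u c).card ≤ (φ.nb u c).card := by
  classical
  refine le_trans (Nat.mul_le_mul_left _ (card_le_card fun x hx => ?_)) h.2.2
  rw [mem_sdiff] at hx
  exact mem_filter.2 ⟨hx.1, fun hc => hx.2 hc.mem_hull⟩

/-- The hull of a tight neighbourhood is an atom, with a better constant than required. -/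
lemma EdgeColoring.IsTight.hull_atom {u : Fin n} {c : Fin ℓ} (h : φ.IsTight u c) :
    2 ≤ (φ.hull u c).card ∧ ∀ v ∈ φ.hull u c, 20 * φ.dis v (φ.hull u c) c ≤ (φ.hull u c).card := by
  have h1 := h.card_hull_sdiff_le
  have h2 := h.card_sdiff_hull_le
  have h3 := h.1
  have h4 := le_card_sdiff (φ.hull u c) (φ.nb u c)
  refine ⟨by omega, fun v hv => ?_⟩
  have h5 := dis_le_dis_add (φ := φ) v (φ.hull u c) (φ.nb u c) c
  rw [hammingDist_ind_eq] at h5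
  rw [CCC.mem_hull] at hv
  omega

end atoms

/-! ### Chromatic clusterings and their errors -/

section clusterings

variable {n ℓ : ℕ} {φ : EdgeColoring n ℓ}

lemma Label.code_inj {x y : Label ℓ} (hx : x ≠ .zero) (hy : y ≠ .zero) :
    x.code = y.code ↔ x = y := by
  cases x <;> cases y <;> simp_all [Label.code, Fin.ext_iff]

lemma EdgeColoring.label_ne_zero (φ : EdgeColoring n ℓ) {u v : Fin n} (h : u ≠ v) :
    φ.label u v ≠ .zero := fun h' => h ((φ.zero_iff u v).1 h')

lemma EdgeColoring.label_self (φ : EdgeColoring n ℓ) (u : Fin n) : φ.label u u = .zero :=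
  (φ.zero_iff u u).2 rfl

lemma mem_nb_of_ne {u v : Fin n} {c : Fin ℓ} (h : v ≠ u) :
    v ∈ φ.nb u c ↔ φ.label u v = .color c := by
  rw [← Label.code_inj (φ.label_ne_zero h.symm) (by simp)]
  unfold EdgeColoring.nb
  rw [mem_filter, EdgeColoring.row, if_neg h]
  simp [Label.code]

variable (φ) in
/-- The ordered pairs in which a clustering disagrees with the instance. -/
def EdgeColoring.errs (Φ : ChromaticClustering n ℓ) : Finset (Fin n × Fin n) :=
  univ.filter fun p => φ.label p.1 p.2 ≠ Φ.label p.1 p.2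

variable (φ) in
/-- The number of vertices that are joined to `u` by an edge with a colour. -/
def EdgeColoring.deg (u : Fin n) : ℕ :=
  (univ.filter fun v => v ≠ u ∧ φ.label u v ≠ .gamma).card

lemma mem_errs {Φ : ChromaticClustering n ℓ} {u v : Fin n} :
    (u, v) ∈ φ.errs Φ ↔ φ.label u v ≠ Φ.label u v := by
  simp [EdgeColoring.errs]

lemma mem_errs_comm {Φ : ChromaticClustering n ℓ} {u v : Fin n} :
    (u, v) ∈ φ.errs Φ ↔ (v, u) ∈ φ.errs Φ := by
  rw [mem_errs, mem_errs, φ.symm u v, Φ.symm u v]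

/-- The pairs of a set of pairs with first entry in `X`, counted by their first entries. -/
lemma card_filter_fst_mem (X : Finset (Fin n)) (p : Fin n → Fin n → Prop)
    [∀ u v, Decidable (p u v)] :
    (univ.filter fun q : Fin n × Fin n => q.1 ∈ X ∧ p q.1 q.2).card =
      ∑ u ∈ X, (univ.filter fun v => p u v).card := by
  rw [← card_sigma]
  refine card_bij' (fun q _ => ⟨q.1, q.2⟩) (fun q _ => (q.1, q.2)) ?_ ?_ ?_ ?_ <;> simp

lemma card_errs_filter (X : Finset (Fin n)) (Φ : ChromaticClustering n ℓ) :
    ((φ.errs Φ).filter fun q => q.1 ∈ X).card = ∑ u ∈ X, φ.d0 Φ.toEdgeColoring u := by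
  unfold EdgeColoring.d0
  rw [← card_filter_fst_mem]
  refine congrArg card ?_
  ext q
  simp [EdgeColoring.errs, and_comm]

lemma card_errs (Φ : ChromaticClustering n ℓ) :
    (φ.errs Φ).card = ∑ u, φ.d0 Φ.toEdgeColoring u := by
  rw [← card_errs_filter]; simp

lemma card_errs_eq_two_mul_obj (Φ : ChromaticClustering n ℓ) :
    (φ.errs Φ).card = 2 * φ.obj Φ := by
  have h1 : (φ.errs Φ).filter (fun q => q.1 < q.2) = univ.filter fun p : Fin n × Fin n =>
      p.1 < p.2 ∧ φ.label p.1 p.2 ≠ Φ.label p.1 p.2 := by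
    ext q; simp [EdgeColoring.errs, and_comm]
  have h2 : ((φ.errs Φ).filter (fun q => ¬ q.1 < q.2)).card =
      ((φ.errs Φ).filter (fun q => q.1 < q.2)).card := by
    refine card_bij' (fun q _ => q.swap) (fun q _ => q.swap) ?_ ?_ (by simp) (by simp)
    · rintro ⟨u, v⟩ h
      rw [mem_filter] at h ⊢
      refine ⟨mem_errs_comm.1 h.1, ?_⟩
      have hne : u ≠ v := by
        rintro rfl
        exact mem_errs.1 h.1 (by rw [φ.label_self, Φ.label_self])
      exact lt_of_le_of_ne (not_lt.1 h.2) hne.symm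
    · rintro ⟨u, v⟩ h
      rw [mem_filter] at h ⊢
      exact ⟨mem_errs_comm.1 h.1, not_lt.2 (le_of_lt h.2)⟩
  have h3 := card_filter_add_card_filter_not (s := φ.errs Φ) (fun q => q.1 < q.2)
  rw [h2, h1] at h3
  unfold EdgeColoring.obj
  omega

/-- The disagreements of a vertex depend only on its cluster and the colour of this cluster. -/
lemma d0_eq_dis {Φ : ChromaticClustering n ℓ} {u : Fin n} {S : Finset (Fin n)} {c : Fin ℓ}
    (hu : u ∈ S) (h : ∀ v, v ≠ u → Φ.label u v = if v ∈ S then .color c else .gamma) :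
    φ.d0 Φ.toEdgeColoring u = φ.dis u S c := by
  unfold EdgeColoring.d0 EdgeColoring.dis hammingDist
  congr 1
  refine filter_congr fun v _ => ?_
  rcases eq_or_ne v u with rfl | hv
  · simp [EdgeColoring.row, ind, hu, φ.label_self, Φ.label_self]
  · have h1 : ind S c v = (Φ.label u v).code := by
      rw [h v hv]; unfold ind; split_ifs <;> rfl
    rw [h1, EdgeColoring.row, if_neg hv, not_iff_not,
      Label.code_inj (φ.label_ne_zero hv.symm) (Φ.label_ne_zero hv.symm)]

/-! ### Optimal clusterings do not break atoms -/

/-- The clustering that arises from `Φ` when the vertices of `S` leave their clusters and form a new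
cluster of colour `c`. -/
def ChromaticClustering.carve (Φ : ChromaticClustering n ℓ) (S : Finset (Fin n)) (c : Fin ℓ) :
    ChromaticClustering n ℓ where
  label u v := if u = v then .zero else if u ∈ S then (if v ∈ S then .color c else .gamma)
    else if v ∈ S then .gamma else Φ.label u v
  zero_iff u v := by
    have := Φ.zero_iff u v
    split_ifs <;> simp_all
  symm u v := by
    have := Φ.symm u v
    simp only [eq_comm (a := v)]
    split_ifs <;> simp_all
  cluster u v d h w hu hv := by
    have h1 := Φ.cluster u v d
    by_cases huv : u = v
    · simp [huv] at h
    · simp only [huv, hu.symm, hv.symm, if_false] at h ⊢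
      by_cases h2 : u ∈ S <;> by_cases h3 : v ∈ S <;> by_cases h4 : w ∈ S <;>
        simp_all

lemma carve_label {Φ : ChromaticClustering n ℓ} {S : Finset (Fin n)} {c : Fin ℓ} {u v : Fin n}
    (hu : u ∈ S) (h : v ≠ u) :
    (Φ.carve S c).label u v = if v ∈ S then .color c else .gamma := by
  simp [ChromaticClustering.carve, h.symm, hu]

/-- Optimality tested on `Φ.carve S c`: what is gained in the pairs at `X` is at most what the
vertices of `X` pay in their new cluster. The factor `2` accounts for both orders of a pair. -/
lemma sum_gain_le {Φ : ChromaticClustering n ℓ} {S X : Finset (Fin n)} {c : Fin ℓ}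
    (hopt : ∀ Ψ, (φ.errs Φ).card ≤ (φ.errs Ψ).card) (hX : X ⊆ S)
    (hΦ : ∀ u v, u ∉ X → v ∉ X → (Φ.carve S c).label u v = Φ.label u v) :
    ∑ u ∈ X, (univ.filter fun v => φ.label u v = (Φ.carve S c).label u v ∧
      φ.label u v ≠ Φ.label u v).card ≤ ∑ u ∈ X, 2 * φ.dis u S c := by
  set Ψ := Φ.carve S c with hΨ
  rw [← card_filter_fst_mem, ← mul_sum]
  have h1 : ∑ u ∈ X, φ.dis u S c = ((φ.errs Ψ).filter fun q => q.1 ∈ X).card := by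
    rw [card_errs_filter]
    exact sum_congr rfl fun u hu => (d0_eq_dis (hX hu) fun v hv => carve_label (hX hu) hv).symm
  have h2 : ((φ.errs Ψ).filter fun q => q.2 ∈ X).card =
      ((φ.errs Ψ).filter fun q => q.1 ∈ X).card := by
    refine card_bij' (fun q _ => q.swap) (fun q _ => q.swap) ?_ ?_ (by simp) (by simp)
    · rintro ⟨u, v⟩ h
      rw [mem_filter] at h ⊢
      exact ⟨mem_errs_comm.1 h.1, h.2⟩
    · rintro ⟨u, v⟩ h
      rw [mem_filter] at h ⊢
      exact ⟨mem_errs_comm.1 h.1, h.2⟩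
  have h3 : φ.errs Ψ \ φ.errs Φ ⊆
      ((φ.errs Ψ).filter fun q => q.1 ∈ X) ∪ (φ.errs Ψ).filter fun q => q.2 ∈ X := by
    rintro ⟨u, v⟩ h
    rw [mem_sdiff, mem_errs, mem_errs, not_not] at h
    by_contra hX'
    simp only [mem_union, mem_filter, mem_errs, not_or, not_and] at hX'
    exact h.1 (h.2.trans (hΦ u v (hX'.1 h.1) (hX'.2 h.1)).symm)
  have h4 := (card_le_card h3).trans (card_union_le _ _)
  have h5 := card_sdiff_le_card_sdiff_iff.2 (hopt Ψ)
  have h6 : (univ.filter fun q : Fin n × Fin n => q.1 ∈ X ∧ φ.label q.1 q.2 = Ψ.label q.1 q.2 ∧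
      φ.label q.1 q.2 ≠ Φ.label q.1 q.2).card ≤ (φ.errs Φ \ φ.errs Ψ).card := by
    refine card_le_card ?_
    rintro ⟨u, v⟩ h
    simp only [mem_filter, mem_univ, true_and] at h
    rw [mem_sdiff, mem_errs, mem_errs, not_not]
    exact ⟨h.2.2, h.2.1⟩
  omega

/-- An optimal clustering contains an atom `K` in a cluster `C` of the same colour, which is not
much larger. -/
lemma exists_cluster_of_atom {Φ : ChromaticClustering n ℓ} {K : Finset (Fin n)} {c : Fin ℓ}
    (hopt : ∀ Ψ, (φ.errs Φ).card ≤ (φ.errs Ψ).card) (h2 : 2 ≤ K.card)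
    (hK : ∀ v ∈ K, 20 * φ.dis v K c ≤ K.card) :
    ∃ C : Finset (Fin n), K ⊆ C ∧ 20 * (C \ K).card ≤ 3 * K.card ∧
      ∀ u ∈ C, ∀ v, v ≠ u → Φ.label u v = if v ∈ C then .color c else .gamma := by
  have hne : K.Nonempty := card_pos.1 (by omega)
  -- compared with `Φ.carve K c`, on average the vertices of `K` have their right cluster already
  obtain ⟨a, ha, hgain⟩ := exists_le_of_sum_le hne (sum_gain_le (c := c) hopt (subset_refl K)
    fun u v hu hv => by
      by_cases h : u = v
      · subst h; rw [Φ.label_self]; exact EdgeColoring.label_self _ _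
      · simp [ChromaticClustering.carve, h, hu, hv])
  have hgain' : (univ.filter fun v => Φ.label a v ≠ (Φ.carve K c).label a v).card ≤
      3 * φ.dis a K c := by
    rw [← d0_eq_dis ha fun v hv => carve_label (Φ := Φ) ha hv] at hgain ⊢
    unfold EdgeColoring.d0 at hgain ⊢
    have h1 : (univ.filter fun v => Φ.label a v ≠ (Φ.carve K c).label a v) ⊆
        (univ.filter fun v => φ.label a v = (Φ.carve K c).label a v ∧
          φ.label a v ≠ Φ.label a v) ∪
        univ.filter fun v => φ.label a v ≠ (Φ.carve K c).label a v := by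
      intro v hv
      simp only [mem_filter, mem_univ, true_and, mem_union] at hv ⊢
      by_cases h : φ.label a v = (Φ.carve K c).label a v
      · left; exact ⟨h, fun h' => hv (h'.symm.trans h)⟩
      · right; exact h
    have h2 := (card_le_card h1).trans (card_union_le _ _)
    omega
  set C : Finset (Fin n) := insert a (univ.filter fun v => Φ.label a v = .color c) with hC
  have haC : a ∈ C := mem_insert_self _ _
  have hmem : ∀ {v}, v ≠ a → (v ∈ C ↔ Φ.label a v = .color c) := by
    intro v hv; simp [hC, hv]
  have hsd : (C \ K).card + (K \ C).card ≤ 3 * φ.dis a K c := by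
    rw [← card_union_of_disjoint disjoint_sdiff_sdiff]
    refine (card_le_card fun v hv => ?_).trans hgain'
    rw [mem_filter]
    refine ⟨mem_univ v, ?_⟩
    rw [mem_union, mem_sdiff, mem_sdiff] at hv
    have hva : v ≠ a := by
      rintro rfl
      rcases hv with h | h
      · exact h.2 ha
      · exact h.2 haC
    rw [carve_label ha hva]
    rw [hmem hva] at hv
    rcases hv with ⟨h, h'⟩ | ⟨h, h'⟩
    · simp [h, h']
    · simp [h, h']
  have haK := hK a ha
  have hKC := card_inter_add_card_sdiff K C
  obtain ⟨w, hw, hwa⟩ : ∃ w ∈ C, w ≠ a := by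
    obtain ⟨w, hw, hwa⟩ := exists_mem_ne (show 1 < (K ∩ C).card by omega) a
    exact ⟨w, (mem_inter.1 hw).2, hwa⟩
  -- `C` is a cluster of `Φ`
  have hacl : ∀ v, v ≠ a → Φ.label a v = if v ∈ C then .color c else .gamma := by
    intro v hva
    by_cases hv : v ∈ C
    · rw [if_pos hv, ← hmem hva]; exact hv
    · rw [if_neg hv]
      have hvw : v ≠ w := fun h => hv (h ▸ hw)
      rcases (Φ.cluster a w c ((hmem hwa).1 hw) v hva hvw).2 with h | h
      · exact absurd ((hmem hva).2 h) hv
      · exact h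
  have hcl : ∀ u ∈ C, ∀ v, v ≠ u → Φ.label u v = if v ∈ C then .color c else .gamma := by
    intro u hu v hvu
    rcases eq_or_ne u a with rfl | hua
    · exact hacl v hvu
    rcases eq_or_ne v a with rfl | hva
    · rw [Φ.symm, hacl u hua, if_pos hu, if_pos haC]
    · rw [← (Φ.cluster a u c ((hmem hua).1 hu) v hva hvu).1, hacl v hva]
  refine ⟨C, ?_, by omega, hcl⟩
  -- otherwise the vertices of `K \ C` would be better off in `C`
  rw [← sdiff_eq_empty_iff_subset]
  by_contra hX
  have hout : ∀ {u v}, u ∈ C → v ∉ C → Φ.label u v = .gamma := fun {u v} hu hv => by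
    rw [hcl u hu v (fun h => hv (h ▸ hu)), if_neg hv]
  obtain ⟨u, hu, hgain⟩ := exists_le_of_sum_le (nonempty_iff_ne_empty.2 hX)
    (sum_gain_le (S := C ∪ K) (c := c) hopt (fun x hx => mem_union_right _ (mem_sdiff.1 hx).1)
    fun u v hu hv => by
      by_cases h : u = v
      · subst h; rw [Φ.label_self]; exact EdgeColoring.label_self _ _
      · have hS : ∀ x, x ∉ K \ C → (x ∈ C ∪ K ↔ x ∈ C) := fun x hx => by
          rw [mem_sdiff] at hx; rw [mem_union]; tauto
        simp only [ChromaticClustering.carve, h, hS u hu, hS v hv, if_false]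
        by_cases huC : u ∈ C <;> by_cases hvC : v ∈ C
        · simp [huC, hvC, hcl u huC v (Ne.symm h)]
        · simp [huC, hvC, hout huC hvC]
        · simp [huC, hvC, Φ.symm u v, hout hvC huC]
        · simp [huC, hvC])
  rw [mem_sdiff] at hu
  have h3 : (C ∪ K) \ K = C \ K := by ext x; simp only [mem_sdiff, mem_union]; tauto
  have h4 : K \ (C ∪ K) = ∅ := by ext x; simp only [mem_sdiff, mem_union]; simp; tauto
  have h5 := dis_le_dis_add (φ := φ) u (C ∪ K) K c
  rw [hammingDist_ind_eq, h3, h4, card_empty] at h5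
  have h6 : ((K ∩ C) \ (K \ φ.nb u c)).card ≤ (univ.filter fun v =>
      φ.label u v = (Φ.carve (C ∪ K) c).label u v ∧ φ.label u v ≠ Φ.label u v).card := by
    refine card_le_card fun v hv => ?_
    simp only [mem_sdiff, mem_inter] at hv
    obtain ⟨⟨hvK, hvC⟩, hvn⟩ := hv
    have hvu : v ≠ u := fun h => hu.2 (h ▸ hvC)
    have hφ : φ.label u v = .color c := (mem_nb_of_ne hvu).1 (by tauto)
    rw [mem_filter, carve_label (mem_union_right _ hu.1) hvu,
      if_pos (mem_union_right _ hvK), hφ, Φ.symm, hout hvC hu.2]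
    simp
  have h7 := le_card_sdiff (K \ φ.nb u c) (K ∩ C)
  have h8 := card_sdiff_nb_le_dis (φ := φ) u K c
  have h9 := hK u hu.1
  omega

/-! ### Vertices outside of the atoms pay for their edges -/

variable (φ) in
/-- `v` belongs to one of the atoms of the preclustering. -/
def EdgeColoring.IsAtomVertex (v : Fin n) : Prop :=
  ∃ c r, φ.IsRep r c ∧ v ∈ φ.hull r c

/-- A cluster of small cost is found by the algorithm: the neighbourhood of one of its cheapest
vertices is tight. -/
lemma isTight_of_cheap {C : Finset (Fin n)} {c : Fin ℓ} {u : Fin n} (h2 : 2 ≤ C.card)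
    (hu : 10 ^ 6 * φ.dis u C c ≤ C.card)
    (hC : 10 ^ 6 * ∑ v ∈ C, φ.dis v C c ≤ C.card * C.card) : φ.IsTight u c := by
  classical
  set S := φ.nb u c with hS
  have hCS := card_nb_sdiff_le_dis (φ := φ) u C c
  have hSC := card_sdiff_nb_le_dis (φ := φ) u C c
  have hd := hammingDist_ind_eq C S c
  have hSc := card_le_card_add_hammingDist C S c c
  have hdis : ∀ x, φ.dis x S c ≤ φ.dis x C c + hammingDist (ind C c) (ind S c) :=
    fun x => dis_le_dis_add x S C c
  rw [← hS] at hCS hSC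
  have hB : 10 ^ 6 * (C.filter fun x => C.card < 600 * φ.dis x C c).card ≤ 600 * C.card := by
    have h3 : (C.filter fun x => C.card < 600 * φ.dis x C c).card * C.card ≤
        ∑ v ∈ C, 600 * φ.dis v C c := by
      refine le_trans ?_ (sum_le_sum_of_subset (filter_subset
        (fun x => C.card < 600 * φ.dis x C c) C))
      rw [← smul_eq_mul]
      exact card_nsmul_le_sum _ _ _ fun x hx => (mem_filter.1 hx).2.le
    rw [← mul_sum] at h3
    refine Nat.le_of_mul_le_mul_right (c := C.card) ?_ (by omega)
    rw [mul_assoc, mul_assoc]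
    omega
  refine ⟨show 2 ≤ S.card by omega, show 300 * φ.dis u S c ≤ S.card from ?_, ?_⟩
  · have := hdis u
    omega
  · have h3 : (S.filter fun x => ¬ φ.IsCore u c x) ⊆
        (S \ C) ∪ C.filter fun x => C.card < 600 * φ.dis x C c := by
      intro x hx
      simp only [EdgeColoring.IsCore, mem_filter, mem_union, mem_sdiff, ← hS] at hx ⊢
      by_cases hxC : x ∈ C
      · right
        have := hdis x
        exact ⟨hxC, by omega⟩
      · left; exact ⟨hx.1, hxC⟩
    have h4 := (card_le_card h3).trans (card_union_le _ _)
    rw [← hS]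
    omega

lemma card_le_of_not_isAtomVertex {C : Finset (Fin n)} {c : Fin ℓ} {u w : Fin n} (h2 : 2 ≤ C.card)
    (hu : 10 ^ 6 * φ.dis u C c ≤ C.card)
    (hC : 10 ^ 6 * ∑ v ∈ C, φ.dis v C c ≤ C.card * C.card) (hw : ¬ φ.IsAtomVertex w) :
    C.card ≤ 50 * φ.dis w C c := by
  have ht := isTight_of_cheap h2 hu hC
  obtain ⟨r, c', hr, hd⟩ := ht.exists_isRep
  obtain ⟨x, hx, hx'⟩ := not_disjoint_iff.1 hd
  obtain ⟨rfl, hclose⟩ := hr.1.close ht hx hx'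
  have h3 : ¬ 30 * φ.dis w (φ.nb r c') c' ≤ (φ.nb r c').card := fun h =>
    hw ⟨c', r, hr, mem_hull.2 h⟩
  have h4 := dis_le_dis_add (φ := φ) w (φ.nb r c') (φ.nb u c') c'
  have h5 := dis_le_dis_add (φ := φ) w (φ.nb u c') C c'
  have h6 := card_nb_sdiff_le_dis (φ := φ) u C c'
  have h7 := card_sdiff_nb_le_dis (φ := φ) u C c'
  have h8 := hammingDist_ind_eq C (φ.nb u c') c'
  have h9 := card_le_card_add_hammingDist C (φ.nb u c') c' c'
  have h10 := card_le_card_add_hammingDist (φ.nb u c') (φ.nb r c') c' c'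
  have h11 := card_le_card_add_hammingDist (φ.nb u c') C c' c'
  rw [hammingDist_comm (ind (φ.nb u c') c')] at h4 h10 h11
  omega

lemma mem_clusterOf {Φ : ChromaticClustering n ℓ} {u v : Fin n} :
    v ∈ Φ.clusterOf u ↔ Φ.label u v ≠ .gamma := by
  simp [ChromaticClustering.clusterOf]

lemma mem_clusterOf_self (Φ : ChromaticClustering n ℓ) (u : Fin n) : u ∈ Φ.clusterOf u := by
  rw [mem_clusterOf, Φ.label_self]; simp

/-- The cluster of `u` with its colour; a cluster of at least two vertices has one. -/
lemma exists_color_of_two_le {Φ : ChromaticClustering n ℓ} {u : Fin n}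
    (h : 2 ≤ (Φ.clusterOf u).card) : ∃ c, ∀ x ∈ Φ.clusterOf u, ∀ v, v ≠ x →
      Φ.label x v = if v ∈ Φ.clusterOf u then .color c else .gamma := by
  obtain ⟨w, hw, hwu⟩ := exists_mem_ne (show 1 < (Φ.clusterOf u).card by omega) u
  rw [mem_clusterOf] at hw
  have hcol : ∀ {v}, v ≠ u → Φ.label u v ≠ .gamma → ∃ c, Φ.label u v = .color c := by
    intro v hv hg
    cases hc : Φ.label u v with
    | zero => exact absurd ((Φ.zero_iff u v).1 hc) hv.symm
    | color c => exact ⟨c, rfl⟩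
    | gamma => exact absurd hc hg
  obtain ⟨c, hc⟩ := hcol hwu hw
  have hu : ∀ v, v ≠ u → Φ.label u v = if v ∈ Φ.clusterOf u then .color c else .gamma := by
    intro v hv
    rcases eq_or_ne v w with rfl | hvw
    · rw [if_pos (mem_clusterOf.2 hw), hc]
    · rcases (Φ.cluster u w c hc v hv hvw).2 with h | h <;> simp [mem_clusterOf, h]
  refine ⟨c, fun x hx v hvx => ?_⟩
  rcases eq_or_ne x u with rfl | hxu
  · exact hu v hvx
  have hux : Φ.label u x = .color c := by rw [hu x hxu, if_pos hx]
  rcases eq_or_ne v u with rfl | hvu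
  · rw [Φ.symm, hux, if_pos (mem_clusterOf_self Φ v)]
  · rw [← (Φ.cluster u x c hux v hvu hvx).1, hu v hvu]

lemma clusterOf_eq {Φ : ChromaticClustering n ℓ} {u v : Fin n} (h : v ∈ Φ.clusterOf u) :
    Φ.clusterOf v = Φ.clusterOf u := by
  rcases eq_or_ne v u with rfl | hvu
  · rfl
  obtain ⟨c, hc⟩ := exists_color_of_two_le (Φ := Φ) (u := u)
    (one_lt_card.2 ⟨v, h, u, mem_clusterOf_self Φ u, hvu⟩)
  ext x
  rcases eq_or_ne x v with rfl | hx
  · exact iff_of_true (mem_clusterOf_self Φ x) h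
  · rw [mem_clusterOf, hc v h x hx]
    split_ifs with h' <;> simp [h']

lemma deg_le_card_add_d0 (Φ : ChromaticClustering n ℓ) (u : Fin n) :
    φ.deg u ≤ (Φ.clusterOf u).card - 1 + φ.d0 Φ.toEdgeColoring u := by
  rw [← card_erase_of_mem (mem_clusterOf_self Φ u)]
  refine (card_le_card fun v hv => ?_).trans (card_union_le _ _)
  simp only [mem_filter, mem_univ, true_and, mem_union, mem_erase, mem_clusterOf] at hv ⊢
  by_cases h : Φ.label u v = .gamma
  · right; rw [h]; exact hv.2
  · left; exact ⟨hv.1, h⟩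

/-- The degree of a vertex outside of the atoms is charged to its own disagreements in an arbitrary
clustering and to the average disagreement in its cluster. -/
lemma deg_le_of_not_isAtomVertex (Φ : ChromaticClustering n ℓ) {u : Fin n}
    (hu : ¬ φ.IsAtomVertex u) :
    (φ.deg u : ℝ) ≤ 51 * φ.d0 Φ.toEdgeColoring u +
      10 ^ 6 * ((∑ v ∈ Φ.clusterOf u, φ.d0 Φ.toEdgeColoring v : ℕ) / ((Φ.clusterOf u).card : ℝ)) := by
  set C := Φ.clusterOf u with hC
  set D := ∑ v ∈ C, φ.d0 Φ.toEdgeColoring v with hD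
  have huC : u ∈ C := mem_clusterOf_self Φ u
  have hpos : 0 < C.card := card_pos.2 ⟨u, huC⟩
  have hposR : (0 : ℝ) < C.card := by exact_mod_cast hpos
  have hdeg := deg_le_card_add_d0 (φ := φ) Φ u
  rw [← hC] at hdeg
  have hnn : (0 : ℝ) ≤ 10 ^ 6 * ((D : ℝ) / (C.card : ℝ)) := by positivity
  by_cases h50 : C.card ≤ 50 * φ.d0 Φ.toEdgeColoring u ∨ C.card = 1
  · have h1 : φ.deg u ≤ 51 * φ.d0 Φ.toEdgeColoring u := by omega
    have h2 : (φ.deg u : ℝ) ≤ 51 * φ.d0 Φ.toEdgeColoring u := by exact_mod_cast h1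
    linarith
  push Not at h50
  by_cases hbad : C.card * C.card ≤ 10 ^ 6 * D
  · have h1 : (C.card : ℝ) ≤ 10 ^ 6 * ((D : ℝ) / (C.card : ℝ)) := by
      rw [← mul_div_assoc, le_div_iff₀ hposR]
      exact_mod_cast hbad
    have h2 : (φ.deg u : ℝ) ≤ C.card + φ.d0 Φ.toEdgeColoring u := by
      exact_mod_cast hdeg.trans (by omega)
    have h3 : (0 : ℝ) ≤ φ.d0 Φ.toEdgeColoring u := Nat.cast_nonneg _
    linarith
  -- a cheap cluster: all of its vertices outside of the atoms have many disagreements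
  exfalso
  obtain ⟨c, hc⟩ := exists_color_of_two_le (Φ := Φ) (u := u) (by rw [← hC]; omega)
  have hdis : ∀ x ∈ C, φ.d0 Φ.toEdgeColoring x = φ.dis x C c := fun x hx =>
    d0_eq_dis hx (hc x hx)
  have hD' : D = ∑ v ∈ C, φ.dis v C c := sum_congr rfl hdis
  obtain ⟨x, hx, hxd⟩ := exists_le_of_sum_le (s := C) (f := fun v => 10 ^ 6 * φ.dis v C c)
    (g := fun _ => C.card) ⟨u, huC⟩ (by
      rw [← mul_sum, ← hD', sum_const, smul_eq_mul]; omega)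
  have := card_le_of_not_isAtomVertex (by omega) hxd (by rw [← hD']; omega) hu
  rw [hdis u huC] at h50
  omega

lemma sum_deg_le (Φ : ChromaticClustering n ℓ) (X : Finset (Fin n))
    (hX : ∀ u ∈ X, ¬ φ.IsAtomVertex u) :
    (∑ u ∈ X, φ.deg u : ℝ) ≤ 10 ^ 7 * (φ.errs Φ).card := by
  classical
  have hsum : ∑ u, ((∑ v ∈ Φ.clusterOf u, φ.d0 Φ.toEdgeColoring v : ℕ) : ℝ) /
      ((Φ.clusterOf u).card : ℝ) = ∑ v, (φ.d0 Φ.toEdgeColoring v : ℝ) := by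
    have hcomm : ∀ u v, v ∈ Φ.clusterOf u ↔ u ∈ Φ.clusterOf v := fun u v => by
      rw [mem_clusterOf, mem_clusterOf, Φ.symm]
    calc _ = ∑ u, ∑ v ∈ Φ.clusterOf u,
          (φ.d0 Φ.toEdgeColoring v : ℝ) / ((Φ.clusterOf v).card : ℝ) := by
          refine sum_congr rfl fun u _ => ?_
          push_cast
          rw [sum_div]
          exact sum_congr rfl fun v hv => by rw [clusterOf_eq hv]
      _ = ∑ v, ∑ _u ∈ Φ.clusterOf v,
          (φ.d0 Φ.toEdgeColoring v : ℝ) / ((Φ.clusterOf v).card : ℝ) :=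
          sum_comm' fun u v => by simp [hcomm u v]
      _ = _ := by
          refine sum_congr rfl fun v _ => ?_
          rw [sum_const, nsmul_eq_mul]
          have : ((Φ.clusterOf v).card : ℝ) ≠ 0 := by
            exact_mod_cast (card_pos.2 ⟨v, mem_clusterOf_self Φ v⟩).ne'
          field_simp
  rw [card_errs]
  push_cast
  have h0 : (0 : ℝ) ≤ ∑ v, (φ.d0 Φ.toEdgeColoring v : ℝ) := sum_nonneg fun _ _ => Nat.cast_nonneg _
  calc (∑ u ∈ X, φ.deg u : ℝ) ≤ ∑ u ∈ X, (51 * (φ.d0 Φ.toEdgeColoring u : ℝ) +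
        10 ^ 6 * ((∑ v ∈ Φ.clusterOf u, φ.d0 Φ.toEdgeColoring v : ℕ) /
          ((Φ.clusterOf u).card : ℝ))) :=
        sum_le_sum fun u hu => deg_le_of_not_isAtomVertex Φ (hX u hu)
    _ ≤ ∑ u, (51 * (φ.d0 Φ.toEdgeColoring u : ℝ) +
        10 ^ 6 * ((∑ v ∈ Φ.clusterOf u, φ.d0 Φ.toEdgeColoring v : ℕ) /
          ((Φ.clusterOf u).card : ℝ))) :=
        sum_le_univ_sum_of_nonneg fun u => by positivity
    _ ≤ _ := by
        rw [sum_add_distrib, ← mul_sum, ← mul_sum, hsum]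
        linarith

end clusterings

section preclustering

variable {n ℓ : ℕ} {φ : EdgeColoring n ℓ}

/-! ### The atoms as a clustering -/

open Classical in
variable (φ) in
/-- The clustering whose clusters with at least two vertices are the hulls of the representatives. -/
noncomputable def EdgeColoring.atoms : ChromaticClustering n ℓ where
  label u v := if u = v then .zero else
    if h : ∃ c r, φ.IsRep r c ∧ u ∈ φ.hull r c ∧ v ∈ φ.hull r c then .color h.choose else .gamma
  zero_iff u v := by split_ifs <;> simp_all
  symm u v := by simp only [eq_comm (a := v), and_comm (a := v ∈ _)]
  cluster u v d h w hu hv := by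
    have hd : ∃ r, φ.IsRep r d ∧ u ∈ φ.hull r d ∧ v ∈ φ.hull r d := by
      by_cases huv : u = v
      · simp [huv] at h
      · rw [if_neg huv] at h
        split_ifs at h with h'
        simp only [Label.color.injEq] at h
        exact h ▸ h'.choose_spec
    obtain ⟨r, hr, hur, hvr⟩ := hd
    have key : ∀ x ∈ φ.hull r d, w ≠ x →
        (if x = w then .zero else if h : ∃ c r, φ.IsRep r c ∧ x ∈ φ.hull r c ∧ w ∈ φ.hull r c
          then .color h.choose else .gamma : Label ℓ) =
        if w ∈ φ.hull r d then .color d else .gamma := by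
      intro x hx hwx
      rw [if_neg hwx.symm]
      by_cases h' : ∃ c r, φ.IsRep r c ∧ x ∈ φ.hull r c ∧ w ∈ φ.hull r c
      · obtain ⟨r', hr', hx', hw'⟩ := h'.choose_spec
        obtain ⟨h1, h2⟩ := hr.eq_of_mem_hull hr' hx hx'
        rw [dif_pos h', if_pos (by rw [h1, h2]; exact hw'), ← h2]
      · rw [dif_neg h', if_neg fun hw => h' ⟨d, r, hr, hx, hw⟩]
    rw [key u hur hu, key v hvr hv]
    refine ⟨rfl, ?_⟩
    split_ifs <;> simp

lemma atoms_label_eq_color {u v : Fin n} {c : Fin ℓ} : φ.atoms.label u v = .color c ↔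
    u ≠ v ∧ ∃ r, φ.IsRep r c ∧ u ∈ φ.hull r c ∧ v ∈ φ.hull r c := by
  classical
  by_cases huv : u = v
  · subst huv; simp [EdgeColoring.label_self]
  have hl : φ.atoms.label u v = if h : ∃ c r, φ.IsRep r c ∧ u ∈ φ.hull r c ∧ v ∈ φ.hull r c then
      .color h.choose else .gamma := if_neg huv
  rw [hl]
  constructor
  · intro h
    refine ⟨huv, ?_⟩
    split_ifs at h with h'
    simp only [Label.color.injEq] at h
    exact h ▸ h'.choose_spec
  · rintro ⟨-, r, hr, hu, hv⟩
    have h' : ∃ c r, φ.IsRep r c ∧ u ∈ φ.hull r c ∧ v ∈ φ.hull r c := ⟨c, r, hr, hu, hv⟩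
    obtain ⟨r', hr', hu', hv'⟩ := h'.choose_spec
    rw [dif_pos h', ← (hr.eq_of_mem_hull hr' hu hu').2]

lemma EdgeColoring.IsRep.atoms_label {r u : Fin n} {c : Fin ℓ} (hr : φ.IsRep r c)
    (hu : u ∈ φ.hull r c) {v : Fin n} (hv : v ≠ u) :
    φ.atoms.label u v = if v ∈ φ.hull r c then .color c else .gamma := by
  split_ifs with h
  · exact atoms_label_eq_color.2 ⟨hv.symm, r, hr, hu, h⟩
  · cases hl : φ.atoms.label u v with
    | zero => exact absurd ((φ.atoms.zero_iff u v).1 hl) hv.symm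
    | gamma => rfl
    | color c' =>
      obtain ⟨-, r', hr', hu', hv'⟩ := atoms_label_eq_color.1 hl
      obtain ⟨rfl, rfl⟩ := hr.eq_of_mem_hull hr' hu hu'
      exact absurd hv' h

lemma EdgeColoring.IsRep.mem_clusterOf {r u v : Fin n} {c : Fin ℓ} (hr : φ.IsRep r c)
    (hu : u ∈ φ.hull r c) : v ∈ φ.atoms.clusterOf u ↔ v ∈ φ.hull r c := by
  rcases eq_or_ne v u with rfl | hv
  · exact iff_of_true (mem_clusterOf_self _ _) hu
  · rw [CCC.mem_clusterOf, hr.atoms_label hu hv]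
    split_ifs with h <;> simp [h]

lemma isAtomVertex_of_mem_clusterOf {u v : Fin n} (hv : v ∈ φ.atoms.clusterOf u) (h : v ≠ u) :
    φ.IsAtomVertex u ∧ φ.IsAtomVertex v := by
  rw [CCC.mem_clusterOf] at hv
  cases hl : φ.atoms.label u v with
  | zero => exact absurd ((φ.atoms.zero_iff u v).1 hl) h.symm
  | gamma => exact absurd hl hv
  | color c =>
    obtain ⟨-, r, hr, hu, hv⟩ := atoms_label_eq_color.1 hl
    exact ⟨⟨c, r, hr, hu⟩, ⟨c, r, hr, hv⟩⟩

lemma isAtomic_atoms : φ.atoms.IsAtomic φ := by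
  intro u h2
  obtain ⟨w, hw, hwu⟩ := exists_mem_ne (show 1 < (φ.atoms.clusterOf u).card by omega) u
  obtain ⟨c, r, hr, hu⟩ := (isAtomVertex_of_mem_clusterOf hw hwu).1
  have h3 : φ.atoms.clusterOf u = φ.hull r c := by
    ext v; exact hr.mem_clusterOf hu
  rw [d0_eq_dis hu fun v hv => hr.atoms_label hu hv, h3]
  obtain ⟨h4, h5⟩ := hr.1.hull_atom
  have h6 : (20 * φ.dis u (φ.hull r c) c : ℝ) ≤ (φ.hull r c).card := by exact_mod_cast h5 u hu
  have h7 : (2 : ℝ) ≤ (φ.hull r c).card := by exact_mod_cast h4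
  linarith

/-! ### Admissible edges -/

open Classical in
variable (φ) in
/-- The total weight of the vertices `w` that are joined to `u` in the colour `c`, and that are joined
to `v` in any colour or equal to `v`. The weight of `w` is `1 / (deg w + 1)`, scaled by `n` and rounded
down; the scaling keeps the effect of the rounding below a factor of `2`. -/
noncomputable def EdgeColoring.weight (u v : Fin n) (c : Fin ℓ) : ℕ :=
  ∑ w, if φ.label u w = .color c ∧ φ.label v w ≠ .gamma then n / (φ.deg w + 1) else 0

variable (φ) in
/-- Two vertices outside of the atoms, the second of which the first reaches with large weight. -/
def EdgeColoring.IsReachable (k : ℕ) (u v : Fin n) (c : Fin ℓ) : Prop :=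
  ¬ φ.IsAtomVertex u ∧ ¬ φ.IsAtomVertex v ∧ v ≠ u ∧ n ≤ 128 * (k * k) * φ.weight u v c

open Classical in
variable (φ) in
/-- A vertex `u` outside of the atoms and a vertex `v` of an atom of colour `c`, at least a fourth of
which is joined to `u`. -/
def EdgeColoring.IsAttached (u v : Fin n) (c : Fin ℓ) : Prop :=
  ¬ φ.IsAtomVertex u ∧ ∃ r, φ.IsRep r c ∧ v ∈ φ.hull r c ∧
    (φ.hull r c).card ≤ 4 * ((φ.hull r c).filter fun w => φ.label u w ≠ .gamma).card

open Classical in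
variable (φ) in
/-- The admissible edges of colour `c`. -/
noncomputable def EdgeColoring.admissible (k : ℕ) (c : Fin ℓ) : Finset (Sym2 (Fin n)) :=
  (univ.filter fun p : Fin n × Fin n =>
    φ.IsReachable k p.1 p.2 c ∨ φ.IsAttached p.1 p.2 c).image fun p => s(p.1, p.2)

lemma mem_admissible {k : ℕ} {c : Fin ℓ} {u v : Fin n} : s(u, v) ∈ φ.admissible k c ↔
    (φ.IsReachable k u v c ∨ φ.IsAttached u v c) ∨
      (φ.IsReachable k v u c ∨ φ.IsAttached v u c) := by
  classical
  unfold EdgeColoring.admissible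
  rw [mem_image]
  constructor
  · rintro ⟨⟨a, b⟩, h, he⟩
    have h' := (mem_filter.1 h).2
    rcases Sym2.eq_iff.1 he with ⟨rfl, rfl⟩ | ⟨rfl, rfl⟩
    · exact .inl h'
    · exact .inr h'
  · rintro (h | h)
    · exact ⟨(u, v), mem_filter.2 ⟨mem_univ _, h⟩, rfl⟩
    · exact ⟨(v, u), mem_filter.2 ⟨mem_univ _, h⟩, Sym2.eq_swap⟩

lemma notMem_clusterOf_of_mem_admissible {k : ℕ} {c : Fin ℓ} {u v : Fin n}
    (h : s(u, v) ∈ φ.admissible k c) : v ∉ φ.atoms.clusterOf u := by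
  have key : ∀ {u v}, φ.IsReachable k u v c ∨ φ.IsAttached u v c →
      v ≠ u ∧ ¬ φ.IsAtomVertex u := by
    rintro u v (h | h)
    · exact ⟨h.2.2.1, h.1⟩
    · refine ⟨?_, h.1⟩
      rintro rfl
      obtain ⟨h1, r, hr, hv, -⟩ := h
      exact h1 ⟨c, r, hr, hv⟩
  intro hv
  rcases mem_admissible.1 h with h | h
  · exact (key h).2 (isAtomVertex_of_mem_clusterOf hv (key h).1).1
  · exact (key h).2 (isAtomVertex_of_mem_clusterOf hv (key h).1.symm).2

lemma card_label_ne_gamma (w : Fin n) :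
    (univ.filter fun v => φ.label v w ≠ .gamma).card = φ.deg w + 1 := by
  have h : (univ.filter fun v => φ.label v w ≠ .gamma) =
      insert w (univ.filter fun v => v ≠ w ∧ φ.label w v ≠ .gamma) := by
    ext v
    simp only [mem_filter, mem_univ, true_and, mem_insert]
    rcases eq_or_ne v w with rfl | hv
    · simp [φ.label_self]
    · simp [hv, φ.symm v w]
  rw [h, card_insert_of_notMem (by simp)]
  rfl

/-- The weights sent out by `u` in colour `c` have total at most `n` times its degree in the
colour `c`. -/
lemma sum_weight_le (u : Fin n) (c : Fin ℓ) :
    ∑ v, φ.weight u v c ≤ n * (univ.filter fun w => φ.label u w = .color c).card := by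
  classical
  unfold EdgeColoring.weight
  rw [sum_comm, mul_comm, ← smul_eq_mul, ← sum_const, sum_filter]
  refine sum_le_sum fun w _ => ?_
  by_cases h : φ.label u w = .color c
  · simp only [h, true_and, if_true]
    rw [← sum_filter, sum_const, card_label_ne_gamma, smul_eq_mul]
    exact Nat.mul_div_le _ _
  · simp [h]

open Classical in
lemma card_reachable_le {k : ℕ} (u : Fin n) (c : Fin ℓ) :
    (univ.filter fun v => φ.IsReachable k u v c).card ≤
      128 * (k * k) * (univ.filter fun w => φ.label u w = .color c).card := by
  have hn : 0 < n := u.pos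
  refine Nat.le_of_mul_le_mul_right (c := n) ?_ hn
  calc (univ.filter fun v => φ.IsReachable k u v c).card * n
      ≤ ∑ v ∈ univ.filter fun v => φ.IsReachable k u v c, 128 * (k * k) * φ.weight u v c := by
        rw [← smul_eq_mul]
        exact card_nsmul_le_sum _ _ _ fun v hv => (mem_filter.1 hv).2.2.2.2
    _ ≤ ∑ v, 128 * (k * k) * φ.weight u v c := sum_le_sum_of_subset (filter_subset _ _)
    _ ≤ 128 * (k * k) * (n * (univ.filter fun w => φ.label u w = .color c).card) := by
        rw [← mul_sum]; exact Nat.mul_le_mul_left _ (sum_weight_le u c)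
    _ = _ := by ring

lemma sum_card_label_eq_color_le (u : Fin n) :
    ∑ c, (univ.filter fun w => φ.label u w = .color c).card ≤ φ.deg u := by
  classical
  rw [← card_biUnion]
  · refine card_le_card fun w hw => ?_
    simp only [mem_biUnion, mem_filter, mem_univ, true_and] at hw ⊢
    obtain ⟨c, hc⟩ := hw
    refine ⟨?_, by simp [hc]⟩
    rintro rfl
    simp [φ.label_self] at hc
  · intro c _ c' _ hne
    rw [Function.onFun, disjoint_left]
    intro w hw hw'
    rw [mem_filter] at hw hw'
    exact hne (Label.color.inj (hw.2.symm.trans hw'.2))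

open Classical in
/-- The atoms to which `u` is attached are disjoint and a fourth of each is joined to `u`. -/
lemma sum_card_attached_le (u : Fin n) :
    ∑ c, (univ.filter fun v => φ.IsAttached u v c).card ≤ 4 * φ.deg u := by
  by_cases hu : φ.IsAtomVertex u
  · simp [EdgeColoring.IsAttached, hu]
  set T : Fin ℓ → Finset (Fin n) := fun c => univ.filter fun r => φ.IsRep r c with hT
  set N : Fin n → Fin ℓ → Finset (Fin n) := fun r c =>
    (φ.hull r c).filter fun w => φ.label u w ≠ .gamma with hN
  have h1 : ∀ c, (univ.filter fun v => φ.IsAttached u v c).card ≤ ∑ r ∈ T c, 4 * (N r c).card := by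
    intro c
    have h2 : (univ.filter fun v => φ.IsAttached u v c) ⊆
        ((T c).filter fun r => (φ.hull r c).card ≤ 4 * (N r c).card).biUnion
          fun r => φ.hull r c := by
      intro v hv
      obtain ⟨-, r, hr, hv, hle⟩ := (mem_filter.1 hv).2
      exact mem_biUnion.2 ⟨r, mem_filter.2 ⟨mem_filter.2 ⟨mem_univ r, hr⟩, hle⟩, hv⟩
    calc _ ≤ ∑ r ∈ (T c).filter fun r => (φ.hull r c).card ≤ 4 * (N r c).card,
          (φ.hull r c).card := (card_le_card h2).trans card_biUnion_le
      _ ≤ ∑ r ∈ (T c).filter fun r => (φ.hull r c).card ≤ 4 * (N r c).card, 4 * (N r c).card :=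
          sum_le_sum fun r hr => (mem_filter.1 hr).2
      _ ≤ _ := sum_le_sum_of_subset (filter_subset _ _)
  refine (sum_le_sum fun c _ => h1 c).trans ?_
  rw [sum_sigma', ← mul_sum]
  refine Nat.mul_le_mul_left 4 ?_
  rw [← card_biUnion]
  · refine card_le_card fun w hw => ?_
    rw [mem_biUnion] at hw
    obtain ⟨⟨c, r⟩, hr, hw⟩ := hw
    rw [mem_sigma, mem_filter] at hr
    rw [mem_filter] at hw ⊢
    refine ⟨mem_univ _, ?_, hw.2⟩
    rintro rfl
    exact hu ⟨c, r, hr.2.2, hw.1⟩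
  · rintro ⟨c, r⟩ hr ⟨c', r'⟩ hr' hne
    rw [mem_coe, mem_sigma, mem_filter] at hr hr'
    rw [Function.onFun, disjoint_left]
    intro w hw hw'
    obtain ⟨h3, h4⟩ := hr.2.2.eq_of_mem_hull hr'.2.2 (mem_filter.1 hw).1 (mem_filter.1 hw').1
    exact hne (by dsimp only at h3 h4; rw [h3, h4])

open Classical in
lemma sum_card_admissible_le (k : ℕ) : ∑ c, (φ.admissible k c).card ≤
    (128 * (k * k) + 4) * ∑ u ∈ univ.filter fun u => ¬ φ.IsAtomVertex u, φ.deg u := by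
  set X := univ.filter fun u => ¬ φ.IsAtomVertex u with hX
  have h1 : ∀ c, (φ.admissible k c).card ≤
      ∑ u ∈ X, ((univ.filter fun v => φ.IsReachable k u v c).card +
        (univ.filter fun v => φ.IsAttached u v c).card) := by
    intro c
    have h2 : (univ.filter fun p : Fin n × Fin n => φ.IsReachable k p.1 p.2 c ∨
        φ.IsAttached p.1 p.2 c) ⊆ univ.filter fun p : Fin n × Fin n =>
        p.1 ∈ X ∧ (φ.IsReachable k p.1 p.2 c ∨ φ.IsAttached p.1 p.2 c) := by
      intro p hp
      rw [mem_filter] at hp ⊢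
      refine ⟨mem_univ _, mem_filter.2 ⟨mem_univ _, ?_⟩, hp.2⟩
      rcases hp.2 with h | h
      exacts [h.1, h.1]
    refine card_image_le.trans ((card_le_card h2).trans ?_)
    rw [card_filter_fst_mem X fun u v => φ.IsReachable k u v c ∨ φ.IsAttached u v c]
    refine sum_le_sum fun u _ => ?_
    rw [filter_or]
    exact card_union_le _ _
  refine (sum_le_sum fun c _ => h1 c).trans ?_
  rw [sum_comm, mul_sum]
  refine sum_le_sum fun u _ => ?_
  rw [sum_add_distrib, add_mul]
  refine Nat.add_le_add ((sum_le_sum fun c _ => card_reachable_le u c).trans ?_)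
    (sum_card_attached_le u)
  rw [← mul_sum]
  exact Nat.mul_le_mul_left _ (sum_card_label_eq_color_le u)

end preclustering

section nearOptimal

variable {n ℓ : ℕ} {φ : EdgeColoring n ℓ}

/-! ### A near-optimal clustering with admissible edges only -/

/-- The clustering that arises from `Φ` when the vertices of `R` become singletons. -/
def ChromaticClustering.isolate (Φ : ChromaticClustering n ℓ) (R : Finset (Fin n)) :
    ChromaticClustering n ℓ where
  label u v := if u = v then .zero else if u ∈ R ∨ v ∈ R then .gamma else Φ.label u v
  zero_iff u v := by
    have := Φ.zero_iff u v
    split_ifs <;> simp_all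
  symm u v := by simp only [eq_comm (a := v), or_comm (a := v ∈ R), Φ.symm v u]
  cluster u v d h w hu hv := by
    have h1 := Φ.cluster u v d
    by_cases huv : u = v
    · simp [huv] at h
    · simp only [huv, hu.symm, hv.symm, if_false] at h ⊢
      by_cases h2 : u ∈ R <;> by_cases h3 : v ∈ R <;> by_cases h4 : w ∈ R <;> simp_all

lemma isolate_label_of_mem {Φ : ChromaticClustering n ℓ} {R : Finset (Fin n)} {u v : Fin n}
    (h : u ∈ R ∨ v ∈ R) (huv : u ≠ v) : (Φ.isolate R).label u v = .gamma := by
  simp [ChromaticClustering.isolate, huv, h]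

lemma isolate_label_of_notMem {Φ : ChromaticClustering n ℓ} {R : Finset (Fin n)} {u v : Fin n}
    (hu : u ∉ R) (hv : v ∉ R) : (Φ.isolate R).label u v = Φ.label u v := by
  by_cases h : u = v
  · subst h; rw [Φ.label_self, EdgeColoring.label_self]
  · simp [ChromaticClustering.isolate, h, hu, hv]

lemma isolate_label_eq_color {Φ : ChromaticClustering n ℓ} {R : Finset (Fin n)} {u v : Fin n}
    {c : Fin ℓ} (h : (Φ.isolate R).label u v = .color c) :
    u ∉ R ∧ v ∉ R ∧ Φ.label u v = .color c := by
  by_cases huv : u = v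
  · simp [ChromaticClustering.isolate, huv] at h
  by_cases hR : u ∈ R ∨ v ∈ R
  · rw [isolate_label_of_mem hR huv] at h; simp at h
  · push Not at hR
    exact ⟨hR.1, hR.2, by rwa [isolate_label_of_notMem hR.1 hR.2] at h⟩

variable (φ) in
/-- The other vertices in the cluster of `u` to which `u` is joined in the colour of the cluster. -/
def EdgeColoring.agreeing (Φ : ChromaticClustering n ℓ) (u : Fin n) : Finset (Fin n) :=
  univ.filter fun v => v ≠ u ∧ Φ.label u v ≠ .gamma ∧ φ.label u v = Φ.label u v

variable (φ) in
/-- The other vertices in the cluster of `u` to which `u` has a negative edge. -/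
def EdgeColoring.negative (Φ : ChromaticClustering n ℓ) (u : Fin n) : Finset (Fin n) :=
  univ.filter fun v => v ≠ u ∧ Φ.label u v ≠ .gamma ∧ φ.label u v = .gamma

/-- The cost of making one more vertex a singleton, doubled as pairs are ordered here. -/
lemma card_errs_isolate_insert (Φ : ChromaticClustering n ℓ) (R : Finset (Fin n)) (u : Fin n) :
    (φ.errs (Φ.isolate (insert u R))).card + 2 * (φ.negative (Φ.isolate R) u).card ≤
      (φ.errs (Φ.isolate R)).card + 2 * (φ.agreeing (Φ.isolate R) u).card := by
  set Ψ := Φ.isolate R with hΨ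
  set Ψ' := Φ.isolate (insert u R) with hΨ'
  have hsame : ∀ a b, a ≠ u → b ≠ u → Ψ'.label a b = Ψ.label a b := by
    intro a b ha hb
    simp [hΨ, hΨ', ChromaticClustering.isolate, ha, hb]
  have hu : ∀ b, b ≠ u → Ψ'.label u b = .gamma := fun b hb =>
    isolate_label_of_mem (.inl (mem_insert_self u R)) hb.symm
  have hself : ∀ b, φ.label u b ≠ Ψ'.label u b → b ≠ u := by
    rintro b h rfl
    exact h (by rw [φ.label_self, Ψ'.label_self])
  -- the edges at `u` that become wrong
  have h1 : φ.errs Ψ' \ φ.errs Ψ ⊆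
      ({u} ×ˢ φ.agreeing Ψ u) ∪ (φ.agreeing Ψ u ×ˢ {u}) := by
    have key : ∀ b, (u, b) ∈ φ.errs Ψ' → (u, b) ∉ φ.errs Ψ → b ∈ φ.agreeing Ψ u := by
      intro b h h'
      rw [mem_errs] at h
      rw [mem_errs, not_not] at h'
      have hb := hself b h
      rw [hu b hb] at h
      exact mem_filter.2 ⟨mem_univ b, hb, h' ▸ h, h'⟩
    rintro ⟨a, b⟩ h
    rw [mem_sdiff] at h
    rw [mem_union, mem_product, mem_product, mem_singleton, mem_singleton]
    by_cases ha : a = u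
    · subst ha; exact .inl ⟨rfl, key b h.1 h.2⟩
    by_cases hb : b = u
    · subst hb
      exact .inr ⟨key a (mem_errs_comm.1 h.1) fun h' => h.2 (mem_errs_comm.1 h'), rfl⟩
    · rw [mem_errs, mem_errs, hsame a b ha hb] at h
      exact absurd h.1 h.2
  -- the edges at `u` that become right
  have h2 : ({u} ×ˢ φ.negative Ψ u) ∪ (φ.negative Ψ u ×ˢ {u}) ⊆ φ.errs Ψ \ φ.errs Ψ' := by
    have key : ∀ b ∈ φ.negative Ψ u, (u, b) ∈ φ.errs Ψ ∧ (u, b) ∉ φ.errs Ψ' := by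
      intro b hb
      obtain ⟨hb, h3, h4⟩ := (mem_filter.1 hb).2
      rw [mem_errs, mem_errs, not_not, hu b hb, h4]
      exact ⟨h3.symm, rfl⟩
    rintro ⟨a, b⟩ h
    rw [mem_union, mem_product, mem_product, mem_singleton, mem_singleton] at h
    rw [mem_sdiff]
    rcases h with ⟨rfl, h⟩ | ⟨h, rfl⟩
    · exact key b h
    · exact ⟨mem_errs_comm.1 (key a h).1, fun h' => (key a h).2 (mem_errs_comm.1 h')⟩
  have h3 : (({u} ×ˢ φ.negative Ψ u) ∪ (φ.negative Ψ u ×ˢ {u})).card =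
      2 * (φ.negative Ψ u).card := by
    rw [card_union_of_disjoint, card_product, card_product, card_singleton]
    · omega
    · rw [disjoint_left]
      rintro ⟨a, b⟩ h h'
      rw [mem_product, mem_singleton] at h h'
      obtain ⟨rfl, -⟩ := h
      exact (mem_filter.1 h'.1).2.1 rfl
  have h4 := (card_le_card h1).trans (card_union_le _ _)
  rw [card_product, card_product, card_singleton] at h4
  have h5 := card_le_card h2
  rw [h3] at h5
  have h6 := card_sdiff_add_card (φ.errs Ψ) (φ.errs Ψ')
  have h7 := card_sdiff_add_card (φ.errs Ψ') (φ.errs Ψ)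
  rw [union_comm] at h7
  omega

/-- Some vertices outside of the atoms are made singletons, so that the remaining ones are clearly
better off in their clusters. The degrees of the singletons are part of the cost of the new
clustering, so a singleton may be traded for a small multiple of its degree. -/
lemma exists_isolate (Φ : ChromaticClustering n ℓ) (X : Finset (Fin n)) (k : ℕ) :
    ∃ R ⊆ X, (2 * k) * (φ.errs (Φ.isolate R)).card ≤
        (2 * k) * (φ.errs Φ).card + (φ.errs (Φ.isolate R)).card ∧
      ∀ u ∈ X, u ∉ R → φ.deg u + 4 * k * (φ.negative (Φ.isolate R) u).card ≤
        4 * k * (φ.agreeing (Φ.isolate R) u).card := by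
  obtain ⟨R, hR, hmin⟩ := exists_min_image X.powerset
    (fun R => ((2 * k * (φ.errs (Φ.isolate R)).card : ℕ) : ℤ) - ((∑ u ∈ R, φ.deg u : ℕ) : ℤ))
    ⟨∅, empty_mem_powerset X⟩
  rw [mem_powerset] at hR
  refine ⟨R, hR, ?_, fun u hu huR => ?_⟩
  · have h1 := hmin ∅ (empty_mem_powerset X)
    have h2 : φ.errs (Φ.isolate ∅) = φ.errs Φ := by
      ext ⟨u, v⟩
      rw [mem_errs, mem_errs, isolate_label_of_notMem (notMem_empty u) (notMem_empty v)]
    have h3 : ∑ u ∈ R, φ.deg u ≤ (φ.errs (Φ.isolate R)).card := by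
      rw [card_errs]
      refine le_trans (sum_le_sum fun u hu => ?_) (sum_le_univ_sum_of_nonneg fun _ => Nat.zero_le _)
      refine card_le_card fun v hv => ?_
      rw [mem_filter] at hv ⊢
      rw [isolate_label_of_mem (.inl hu) hv.2.1.symm]
      exact ⟨hv.1, hv.2.2⟩
    rw [h2] at h1
    simp only [sum_empty] at h1
    omega
  · have h1 := hmin (insert u R) (by
      rw [mem_powerset]; exact insert_subset hu hR)
    have h2 := card_errs_isolate_insert (φ := φ) Φ R u
    rw [sum_insert huR] at h1
    have h3 := Nat.mul_le_mul_left (2 * k) h2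
    rw [mul_add, mul_add] at h3
    have h4 : 2 * k * (2 * (φ.negative (Φ.isolate R) u).card) =
        4 * k * (φ.negative (Φ.isolate R) u).card := by ring
    have h5 : 2 * k * (2 * (φ.agreeing (Φ.isolate R) u).card) =
        4 * k * (φ.agreeing (Φ.isolate R) u).card := by ring
    omega

lemma agreeing_subset (Φ : ChromaticClustering n ℓ) (u : Fin n) :
    φ.agreeing Φ u ⊆ (Φ.clusterOf u).erase u := by
  intro v hv
  obtain ⟨h1, h2, -⟩ := (mem_filter.1 hv).2
  exact mem_erase.2 ⟨h1, mem_clusterOf.2 h2⟩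

/-- Among the vertices of a cluster, those with an edge in any colour contribute to the degree. -/
lemma card_clusterOf_le (Φ : ChromaticClustering n ℓ) (u : Fin n) :
    (Φ.clusterOf u).card ≤ 1 + φ.deg u + (φ.negative Φ u).card := by
  have h : Φ.clusterOf u ⊆ ({u} ∪ univ.filter fun v => v ≠ u ∧ φ.label u v ≠ .gamma) ∪
      φ.negative Φ u := by
    intro v hv
    rw [mem_clusterOf] at hv
    simp only [EdgeColoring.negative, mem_union, mem_singleton, mem_filter, mem_univ, true_and]
    tauto
  refine (card_le_card h).trans ((card_union_le _ _).trans
    (Nat.add_le_add_right ((card_union_le _ _).trans ?_) _))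
  rw [card_singleton]
  rfl

/-- Two vertices of a cluster of colour `c` that are clearly better off in the cluster: one of them
reaches the other with large weight. -/
lemma le_weight_or_le_weight {Φ : ChromaticClustering n ℓ} {k : ℕ} {u v : Fin n} {c : Fin ℓ}
    (huv : Φ.label u v = .color c)
    (hdeg : ∀ w ∈ Φ.clusterOf u, φ.deg w + 1 ≤ 4 * k * (Φ.clusterOf u).card)
    (hu : φ.deg u + 4 * k * (φ.negative Φ u).card ≤ 4 * k * (φ.agreeing Φ u).card)
    (hv : φ.deg v + 4 * k * (φ.negative Φ v).card ≤ 4 * k * (φ.agreeing Φ v).card) :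
    n ≤ 128 * (k * k) * φ.weight u v c ∨ n ≤ 128 * (k * k) * φ.weight v u c := by
  classical
  have hne : u ≠ v := by rintro rfl; simp [Φ.label_self] at huv
  have hvC : v ∈ Φ.clusterOf u := mem_clusterOf.2 (by simp [huv])
  have hCv := clusterOf_eq hvC
  set C := Φ.clusterOf u with hC
  have h2 : 2 ≤ C.card := one_lt_card.2 ⟨u, mem_clusterOf_self Φ u, v, hvC, hne⟩
  obtain ⟨c', hc'⟩ := exists_color_of_two_le h2
  rw [← hC] at hc'
  obtain rfl : c' = c := by
    have h := hc' u (mem_clusterOf_self Φ u) v hne.symm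
    rw [huv, if_pos hvC] at h
    exact (Label.color.inj h).symm
  set P : Fin n → Fin n → Finset (Fin n) := fun a b =>
    C.filter fun w => φ.label a w = .color c' ∧ φ.label b w ≠ .gamma with hP
  -- the agreeing vertices at `a` that are not negative at `b` begin the desired paths
  have hcount : ∀ a ∈ C, ∀ b ∈ C, (φ.agreeing Φ a).card ≤ (P a b).card + (φ.negative Φ b).card := by
    intro a ha b hb
    refine (card_le_card fun w hw => ?_).trans (card_union_le _ _)
    obtain ⟨hwa, hg, heq⟩ := (mem_filter.1 hw).2
    rw [hc' a ha w hwa] at hg heq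
    have hwC : w ∈ C := by by_contra h; simp [h] at hg
    rw [if_pos hwC] at heq
    rw [mem_union, mem_filter]
    by_cases hbw : φ.label b w = .gamma
    · right
      have hwb : w ≠ b := by rintro rfl; simp [φ.label_self] at hbw
      exact mem_filter.2 ⟨mem_univ w, hwb, by simp [hc' b hb w hwb, hwC], hbw⟩
    · left; exact ⟨hwC, heq, hbw⟩
  have h3 := hcount u (mem_clusterOf_self Φ u) v hvC
  have h4 := hcount v hvC u (mem_clusterOf_self Φ u)
  have h5 := card_clusterOf_le (φ := φ) Φ u
  have h6 := card_clusterOf_le (φ := φ) Φ v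
  rw [← hC] at h5
  rw [hCv] at h6
  have hk : 1 ≤ k := by
    by_contra h
    have h7 := hdeg u (mem_clusterOf_self Φ u)
    have : k = 0 := by omega
    subst this
    omega
  have hy : ∀ a, φ.deg a + 4 * k * (φ.negative Φ a).card ≤ 4 * k * (φ.agreeing Φ a).card →
      (φ.negative Φ a).card ≤ φ.deg a := by
    intro a ha
    have h8 : (φ.negative Φ a).card ≤ (φ.agreeing Φ a).card :=
      Nat.le_of_mul_le_mul_left (show 4 * k * _ ≤ 4 * k * _ by omega) (by omega)
    refine h8.trans (card_le_card fun w hw => ?_)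
    rw [EdgeColoring.agreeing, mem_filter] at hw
    exact mem_filter.2 ⟨hw.1, hw.2.1, by rw [hw.2.2.2]; exact hw.2.2.1⟩
  have h7 := hy u hu
  have h8 := hy v hv
  have h9 : C.card ≤ 8 * k * ((P u v).card + (P v u).card) := by
    have h10 := Nat.mul_le_mul_left (4 * k) (Nat.add_le_add h3 h4)
    have h11 : 8 * k * ((P u v).card + (P v u).card) =
      2 * (4 * k * ((P u v).card + (P v u).card)) := by ring
    rw [h11]
    simp only [mul_add] at h10 ⊢
    omega
  -- all weights are large, as no degree is larger than `4 * k * C.card`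
  have hw : ∀ w ∈ C, n ≤ 8 * k * C.card * (n / (φ.deg w + 1)) := by
    intro w hw
    have hle : φ.deg w + 1 ≤ n := by
      rw [← card_label_ne_gamma]; exact (card_filter_le _ _).trans (by simp)
    have h10 := hdeg w hw
    have h11 : n < (φ.deg w + 1) * (n / (φ.deg w + 1) + 1) := Nat.lt_mul_div_succ n (by omega)
    have h12 : 1 ≤ n / (φ.deg w + 1) := (Nat.one_le_div_iff (by omega)).2 hle
    calc n ≤ (φ.deg w + 1) * (n / (φ.deg w + 1) + 1) := h11.le
      _ ≤ (4 * k * C.card) * (2 * (n / (φ.deg w + 1))) := Nat.mul_le_mul h10 (by omega)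
      _ = _ := by ring
  have hweight : ∀ a b, C.card ≤ 16 * k * (P a b).card →
      n ≤ 128 * (k * k) * φ.weight a b c' := by
    intro a b hab
    have h10 : (P a b).card * n ≤ 8 * k * C.card * φ.weight a b c' := by
      calc (P a b).card * n ≤ ∑ w ∈ P a b, 8 * k * C.card * (n / (φ.deg w + 1)) := by
            rw [← smul_eq_mul]
            exact card_nsmul_le_sum _ _ _ fun w h => hw w (mem_filter.1 h).1
        _ ≤ 8 * k * C.card * φ.weight a b c' := by
            rw [← mul_sum]
            refine Nat.mul_le_mul_left _ ?_
            unfold EdgeColoring.weight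
            rw [← sum_filter]
            exact sum_le_sum_of_subset fun w h =>
              mem_filter.2 ⟨mem_univ w, (mem_filter.1 h).2⟩
    refine Nat.le_of_mul_le_mul_left (c := C.card) ?_ (by omega)
    calc C.card * n ≤ 16 * k * (P a b).card * n := Nat.mul_le_mul_right _ hab
      _ = 16 * k * ((P a b).card * n) := by ring
      _ ≤ 16 * k * (8 * k * C.card * φ.weight a b c') := Nat.mul_le_mul_left _ h10
      _ = _ := by ring
  have h10 : 8 * k * ((P u v).card + (P v u).card) = 8 * k * (P u v).card + 8 * k * (P v u).card :=
    mul_add _ _ _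
  have h11 : ∀ x, 16 * k * x = 2 * (8 * k * x) := fun x => by ring
  by_cases h12 : C.card ≤ 16 * k * (P u v).card
  · exact .inl (hweight u v h12)
  · refine .inr (hweight v u ?_)
    rw [h11] at h12 ⊢
    omega

/-- A vertex that prefers its cluster to being a singleton is attached to an atom that makes up
most of the cluster. -/
lemma card_le_four_mul_of_prefers {Φ : ChromaticClustering n ℓ} {k : ℕ} {u : Fin n}
    {K : Finset (Fin n)} (hk : 1 ≤ k) (huK : u ∉ K) (hKC : K ⊆ Φ.clusterOf u)
    (hC : 20 * (Φ.clusterOf u \ K).card ≤ 3 * K.card)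
    (hu : φ.deg u + 4 * k * (φ.negative Φ u).card ≤ 4 * k * (φ.agreeing Φ u).card) :
    K.card ≤ 4 * (K.filter fun w => φ.label u w ≠ .gamma).card := by
  have h1 : (φ.negative Φ u).card ≤ (φ.agreeing Φ u).card :=
    Nat.le_of_mul_le_mul_left (show 4 * k * _ ≤ 4 * k * _ by omega) (by omega)
  have h2 : (K.filter fun w => ¬ φ.label u w ≠ .gamma).card ≤ (φ.negative Φ u).card := by
    refine card_le_card fun w hw => ?_
    rw [mem_filter, not_not] at hw
    exact mem_filter.2 ⟨mem_univ w, fun h => huK (h ▸ hw.1), mem_clusterOf.1 (hKC hw.1), hw.2⟩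
  have h3 : φ.agreeing Φ u ⊆
      (K.filter fun w => φ.label u w ≠ .gamma) ∪ (Φ.clusterOf u \ K) := by
    intro w hw
    have hwC := (mem_erase.1 (agreeing_subset Φ u hw)).2
    obtain ⟨-, h4, h5⟩ := (mem_filter.1 hw).2
    rw [mem_union, mem_filter, mem_sdiff]
    by_cases hwK : w ∈ K
    · exact .inl ⟨hwK, h5 ▸ h4⟩
    · exact .inr ⟨hwC, hwK⟩
  have h4 := (card_le_card h3).trans (card_union_le _ _)
  have h5 := card_filter_add_card_filter_not (s := K) (fun w => φ.label u w ≠ .gamma)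
  omega

/-- From an optimal clustering one obtains a clustering that costs little more, contains every atom in
a cluster of the same colour, and otherwise has only admissible edges inside its clusters. The size of
the clusters relative to their atoms shows that there is at most one atom in each. -/
lemma exists_nearOptimal {Φ : ChromaticClustering n ℓ} {k : ℕ} (hk : 1 ≤ k)
    (hopt : ∀ Ψ, (φ.errs Φ).card ≤ (φ.errs Ψ).card) :
    ∃ Φ₁ : ChromaticClustering n ℓ,
      (2 * k) * (φ.errs Φ₁).card ≤ (2 * k) * (φ.errs Φ).card + (φ.errs Φ₁).card ∧
      Φ₁.DoesNotBreak φ.atoms ∧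
      ∀ u v c, Φ₁.label u v = .color c →
        v ∈ φ.atoms.clusterOf u ∨ s(u, v) ∈ φ.admissible k c := by
  classical
  obtain ⟨R, hR, herr, hpref⟩ := exists_isolate (φ := φ) Φ
    (univ.filter fun u => ¬ φ.IsAtomVertex u) k
  have hatom : ∀ r c, φ.IsRep r c → ∃ C : Finset (Fin n), φ.hull r c ⊆ C ∧
      20 * (C \ φ.hull r c).card ≤ 3 * (φ.hull r c).card ∧
      ∀ u ∈ C, ∀ v, v ≠ u → Φ.label u v = if v ∈ C then .color c else .gamma := fun r c hr =>
    exists_cluster_of_atom hopt hr.1.hull_atom.1 hr.1.hull_atom.2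
  have hRhull : ∀ r c v, φ.IsRep r c → v ∈ φ.hull r c → v ∉ R := fun r c v hr hv hvR =>
    (mem_filter.1 (hR hvR)).2 ⟨c, r, hr, hv⟩
  set Ψ := Φ.isolate R with hΨ
  have hnotR : ∀ u, ¬ φ.IsAtomVertex u → u ∉ R →
      φ.deg u + 4 * k * (φ.negative Ψ u).card ≤ 4 * k * (φ.agreeing Ψ u).card := fun u hu huR =>
    hpref u (mem_filter.2 ⟨mem_univ u, hu⟩) huR
  -- the cluster of an atom in the new clustering
  have hhull : ∀ r c u, φ.IsRep r c → u ∈ φ.hull r c → ∃ C : Finset (Fin n), φ.hull r c ⊆ C ∧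
      20 * (C \ φ.hull r c).card ≤ 3 * (φ.hull r c).card ∧ Ψ.clusterOf u = C ∧
      ∀ v, v ≠ u → Ψ.label u v = if v ∈ C then .color c else .gamma := by
    intro r c u hr hu
    obtain ⟨C, h1, h2, h3⟩ := hatom r c hr
    have huR := hRhull r c u hr hu
    have h4 : ∀ v, v ≠ u → Ψ.label u v = if v ∈ C \ R then .color c else .gamma := by
      intro v hv
      by_cases hvR : v ∈ R
      · rw [hΨ, isolate_label_of_mem (.inr hvR) hv.symm]; simp [hvR]
      · rw [hΨ, isolate_label_of_notMem huR hvR, h3 u (h1 hu) v hv]; simp [hvR]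
    refine ⟨C \ R, fun v hv => mem_sdiff.2 ⟨h1 hv, hRhull r c v hr hv⟩,
      le_trans (Nat.mul_le_mul_left _ (card_le_card
        (sdiff_subset_sdiff sdiff_subset (subset_refl _)))) h2, ?_, h4⟩
    ext v
    rcases eq_or_ne v u with rfl | hv
    · exact iff_of_true (mem_clusterOf_self _ _) (mem_sdiff.2 ⟨h1 hu, huR⟩)
    · rw [mem_clusterOf, h4 v hv]; split_ifs with h <;> simp [h]
  refine ⟨Ψ, herr, ?_, ?_⟩
  · intro u v c huv
    obtain ⟨hne, r, hr, hu, hv⟩ := atoms_label_eq_color.1 huv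
    obtain ⟨C, h1, -, -, h4⟩ := hhull r c u hr hu
    rw [h4 v hne.symm, if_pos (h1 hv)]
  -- a vertex outside of the atoms and one of an atom
  have hattach : ∀ u v c, Ψ.label u v = .color c → ¬ φ.IsAtomVertex u → φ.IsAtomVertex v →
      φ.IsAttached u v c := by
    rintro u v c huv hu ⟨c', r, hr, hv⟩
    have hne : u ≠ v := by rintro rfl; exact hu ⟨c', r, hr, hv⟩
    obtain ⟨C, h1, h2, h3, h4⟩ := hhull r c' v hr hv
    have huC : u ∈ C := by
      rw [← h3, mem_clusterOf, Ψ.symm, huv]; simp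
    obtain rfl : c' = c := by
      have := h4 u hne
      rw [Ψ.symm, huv, if_pos huC] at this
      exact (Label.color.inj this).symm
    have h5 : Ψ.clusterOf u = C := by rw [← h3]; exact clusterOf_eq (h3 ▸ huC)
    refine ⟨hu, r, hr, hv, ?_⟩
    exact (card_le_four_mul_of_prefers (Φ := Ψ) hk (fun h => hu ⟨c', r, hr, h⟩)
      (by rw [h5]; exact h1) (by rw [h5]; exact h2)
      (hnotR u hu (isolate_label_eq_color huv).1)).trans_eq (by congr!)
  intro u v c huv
  have hne : u ≠ v := by rintro rfl; simp [Ψ.label_self] at huv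
  have hvu : Ψ.label v u = .color c := by rw [Ψ.symm]; exact huv
  by_cases hu : φ.IsAtomVertex u <;> by_cases hv : φ.IsAtomVertex v
  · left
    obtain ⟨c₁, r₁, hr₁, hu⟩ := hu
    obtain ⟨c₂, r₂, hr₂, hv⟩ := hv
    rw [hr₁.mem_clusterOf hu]
    by_contra hv₁
    obtain ⟨C, h1, h2, h3, h4⟩ := hhull r₁ c₁ u hr₁ hu
    obtain ⟨C', h1', h2', h3', h4'⟩ := hhull r₂ c₂ v hr₂ hv
    have hvC : v ∈ Ψ.clusterOf u := by rw [mem_clusterOf, huv]; simp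
    obtain rfl : C' = C := by rw [← h3, ← h3']; exact clusterOf_eq hvC
    -- two atoms cannot each make up most of a cluster
    have hd : Disjoint (φ.hull r₁ c₁) (φ.hull r₂ c₂) := by
      rw [disjoint_left]
      intro x hx hx'
      obtain ⟨rfl, rfl⟩ := hr₁.eq_of_mem_hull hr₂ hx hx'
      exact hv₁ hv
    have h5 : (φ.hull r₂ c₂).card ≤ (C' \ φ.hull r₁ c₁).card :=
      card_le_card fun x hx => mem_sdiff.2 ⟨h1' hx, disjoint_right.1 hd hx⟩
    have h6 : (φ.hull r₁ c₁).card ≤ (C' \ φ.hull r₂ c₂).card :=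
      card_le_card fun x hx => mem_sdiff.2 ⟨h1 hx, disjoint_left.1 hd hx⟩
    have h7 := hr₁.1.hull_atom.1
    omega
  · exact .inr (mem_admissible.2 (.inr (.inr (hattach v u c hvu hv hu))))
  · exact .inr (mem_admissible.2 (.inl (.inr (hattach u v c huv hu hv))))
  · right
    have hR' := isolate_label_eq_color huv
    have hdeg : ∀ w ∈ Ψ.clusterOf u, φ.deg w + 1 ≤ 4 * k * (Ψ.clusterOf u).card := by
      intro w hw
      have hCw := clusterOf_eq hw
      have hpos : 0 < (Ψ.clusterOf u).card := card_pos.2 ⟨w, hw⟩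
      by_cases hwA : φ.IsAtomVertex w
      · obtain ⟨c', r, hr, hwr⟩ := hwA
        obtain ⟨C, h1, h2, h3, h4⟩ := hhull r c' w hr hwr
        have h5 := hr.1.hull_atom.2 w hwr
        rw [← d0_eq_dis hwr fun x hx => hr.atoms_label hwr hx] at h5
        have h6 := deg_le_card_add_d0 (φ := φ) φ.atoms w
        have h7 : φ.atoms.clusterOf w = φ.hull r c' := by
          ext x; exact hr.mem_clusterOf hwr
        rw [h7] at h6
        rw [hCw] at h3
        have h8 : (φ.hull r c').card ≤ (Ψ.clusterOf u).card := h3 ▸ card_le_card h1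
        have h9 : (Ψ.clusterOf u).card * 4 ≤ 4 * k * (Ψ.clusterOf u).card := by
          rw [mul_comm]; exact Nat.mul_le_mul_right _ (by omega)
        have h10 := hr.1.hull_atom.1
        omega
      · have hwR : w ∉ R := by
          intro hwR
          have hwu : u ≠ w := fun h => hR'.1 (h ▸ hwR)
          rw [mem_clusterOf, hΨ, isolate_label_of_mem (.inr hwR) hwu] at hw
          exact hw rfl
        have h1 := hnotR w hwA hwR
        have h2 := card_le_card (agreeing_subset (φ := φ) Ψ w)
        rw [hCw, card_erase_of_mem hw] at h2
        have h3 : 4 * k * (φ.agreeing Ψ w).card + 4 * k ≤ 4 * k * (Ψ.clusterOf u).card := by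
          rw [← Nat.mul_succ]
          exact Nat.mul_le_mul_left _ (by omega)
        omega
    rcases le_weight_or_le_weight huv hdeg (hnotR u hu hR'.1) (hnotR v hv hR'.2.1) with h | h
    · exact mem_admissible.2 (.inl (.inl ⟨hu, hv, hne.symm, h⟩))
    · exact mem_admissible.2 (.inr (.inl ⟨hv, hu, hne, h⟩))

end nearOptimal

/-! ### The algorithm -/

section algorithm

variable {Γ : Input → Type} [Ctx Γ] {u v x r : ∀ I : Input, Γ I → Fin I.n}
  {c : ∀ I : Input, Γ I → Fin I.l}

lemma Comp.vertex : Comp fun (I : Input) (p : Γ I × Fin I.n) => (p.2 : ℕ) := .var .numVertices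

lemma Comp.color : Comp fun (I : Input) (p : Γ I × Fin I.l) => (p.2 : ℕ) := .var .numColors

lemma decid_vertex_eq (hu : Comp fun I γ => (u I γ : ℕ)) (hv : Comp fun I γ => (v I γ : ℕ)) :
    Decid fun I γ => u I γ = v I γ := by
  convert Decid.eq hu hv using 3
  exact Fin.ext_iff

lemma decid_label_eq_color (hu : Comp fun I γ => (u I γ : ℕ)) (hv : Comp fun I γ => (v I γ : ℕ))
    (hc : Comp fun I γ => (c I γ : ℕ)) :
    Decid fun I γ => I.φ.label (u I γ) (v I γ) = .color (c I γ) := by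
  convert Decid.eq (hu.code hv) (hc.add (.const 1)) using 3 with I γ
  cases I.φ.label (u I γ) (v I γ) <;> simp [Label.code, Fin.ext_iff]

lemma decid_label_ne_gamma (hu : Comp fun I γ => (u I γ : ℕ))
    (hv : Comp fun I γ => (v I γ : ℕ)) :
    Decid fun I γ => I.φ.label (u I γ) (v I γ) ≠ .gamma := by
  convert (decid_vertex_eq hu hv).or (Decid.lt (.const 0) (hu.code hv)) using 3 with I γ
  rw [← I.φ.zero_iff]
  cases I.φ.label (u I γ) (v I γ) <;> simp [Label.code]

lemma comp_row (hu : Comp fun I γ => (u I γ : ℕ)) (hc : Comp fun I γ => (c I γ : ℕ))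
    (hx : Comp fun I γ => (x I γ : ℕ)) : Comp fun I γ => I.φ.row (u I γ) (c I γ) (x I γ) := by
  classical
  convert (Comp.ite (decid_vertex_eq hx hu) (hc.add (.const 1))).add
    (Comp.ite (decid_vertex_eq hx hu).not (hu.code hx)) using 3 with I γ
  unfold EdgeColoring.row
  split_ifs <;> simp

lemma decid_mem_nb (hu : Comp fun I γ => (u I γ : ℕ)) (hc : Comp fun I γ => (c I γ : ℕ))
    (hx : Comp fun I γ => (x I γ : ℕ)) : Decid fun I γ => x I γ ∈ I.φ.nb (u I γ) (c I γ) := by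
  convert Decid.eq (comp_row hu hc hx) (hc.add (.const 1)) using 3 with I γ
  simp [EdgeColoring.nb]

lemma comp_card_nb (hu : Comp fun I γ => (u I γ : ℕ)) (hc : Comp fun I γ => (c I γ : ℕ)) :
    Comp fun I γ => (I.φ.nb (u I γ) (c I γ)).card := by
  unfold EdgeColoring.nb
  refine Comp.card_filter .numVertices ?_
  exact Decid.eq (comp_row hu.weaken hc.weaken .vertex) (hc.weaken.add (.const 1))

lemma comp_dis_nb (hv : Comp fun I γ => (v I γ : ℕ)) (hu : Comp fun I γ => (u I γ : ℕ))
    (hc : Comp fun I γ => (c I γ : ℕ)) :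
    Comp fun I γ => I.φ.dis (v I γ) (I.φ.nb (u I γ) (c I γ)) (c I γ) := by
  unfold EdgeColoring.dis hammingDist
  refine Comp.card_filter .numVertices (Decid.not (Decid.eq ?_ ?_))
  · exact comp_row hv.weaken hc.weaken .vertex
  · exact Comp.ite (decid_mem_nb hu.weaken hc.weaken .vertex) (hc.weaken.add (.const 1))

lemma decid_isCore (hu : Comp fun I γ => (u I γ : ℕ)) (hc : Comp fun I γ => (c I γ : ℕ))
    (hx : Comp fun I γ => (x I γ : ℕ)) : Decid fun I γ => I.φ.IsCore (u I γ) (c I γ) (x I γ) :=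
  Decid.le ((Comp.const 300).mul (comp_dis_nb hx hu hc)) (comp_card_nb hu hc)

lemma decid_isTight (hu : Comp fun I γ => (u I γ : ℕ)) (hc : Comp fun I γ => (c I γ : ℕ)) :
    Decid fun I γ => I.φ.IsTight (u I γ) (c I γ) := by
  classical
  convert (Decid.le (.const 2) (comp_card_nb hu hc)).and ((decid_isCore hu hc hu).and (Decid.le
    ((Comp.const 300).mul (Comp.card_filter .numVertices
      (p := fun I γ x => x ∈ I.φ.nb (u I γ) (c I γ) ∧ ¬ I.φ.IsCore (u I γ) (c I γ) x)
      ((decid_mem_nb hu.weaken hc.weaken .vertex).and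
        (decid_isCore hu.weaken hc.weaken .vertex).not))) (comp_card_nb hu hc))) using 3 with I γ
  unfold EdgeColoring.IsTight
  rw [← filter_filter, filter_mem_eq_inter, univ_inter]

lemma decid_mem_hull (hu : Comp fun I γ => (u I γ : ℕ)) (hc : Comp fun I γ => (c I γ : ℕ))
    (hv : Comp fun I γ => (v I γ : ℕ)) : Decid fun I γ => v I γ ∈ I.φ.hull (u I γ) (c I γ) := by
  convert Decid.le ((Comp.const 30).mul (comp_dis_nb hv hu hc)) (comp_card_nb hu hc) using 3
  exact mem_hull

lemma comp_card_hull (hu : Comp fun I γ => (u I γ : ℕ)) (hc : Comp fun I γ => (c I γ : ℕ)) :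
    Comp fun I γ => (I.φ.hull (u I γ) (c I γ)).card := by
  unfold EdgeColoring.hull
  refine Comp.card_filter .numVertices ?_
  exact Decid.le ((Comp.const 30).mul (comp_dis_nb .vertex hu.weaken hc.weaken))
    (comp_card_nb hu.weaken hc.weaken)

lemma decid_isRep (hr : Comp fun I γ => (r I γ : ℕ)) (hc : Comp fun I γ => (c I γ : ℕ)) :
    Decid fun I γ => I.φ.IsRep (r I γ) (c I γ) := by
  refine (decid_isTight hr hc).and (Decid.forall .numVertices (Decid.forall .numColors
    ((Decid.lt Comp.vertex.weaken hr.weaken.weaken).imp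
      ((decid_isTight Comp.vertex.weaken .color).imp ?_))))
  simp only [disjoint_left]
  exact Decid.forall .numVertices ((decid_mem_hull hr.weaken.weaken.weaken hc.weaken.weaken.weaken
    .vertex).imp (decid_mem_hull Comp.vertex.weaken.weaken Comp.color.weaken .vertex).not)

lemma decid_isAtomVertex (hv : Comp fun I γ => (v I γ : ℕ)) :
    Decid fun I γ => I.φ.IsAtomVertex (v I γ) :=
  Decid.exists .numColors (Decid.exists .numVertices
    ((decid_isRep .vertex Comp.color.weaken).and
      (decid_mem_hull .vertex Comp.color.weaken hv.weaken.weaken)))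

/-- At most one summand is not zero, since the hulls of representatives are disjoint. -/
lemma code_atoms {n ℓ : ℕ} (φ : EdgeColoring n ℓ) (u v : Fin n)
    [∀ c r, Decidable (u ≠ v ∧ φ.IsRep r c ∧ u ∈ φ.hull r c ∧ v ∈ φ.hull r c)] :
    (φ.atoms.label u v).code = ∑ c : Fin ℓ, ∑ r,
      if u ≠ v ∧ φ.IsRep r c ∧ u ∈ φ.hull r c ∧ v ∈ φ.hull r c then (c : ℕ) + 1 else 0 := by
  by_cases h : ∃ c, φ.atoms.label u v = .color c
  · obtain ⟨c, hc⟩ := h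
    obtain ⟨hne, r, hr, hu, hv⟩ := atoms_label_eq_color.1 hc
    rw [Fintype.sum_eq_single c, Fintype.sum_eq_single r, if_pos ⟨hne, hr, hu, hv⟩, hc]
    · rfl
    · exact fun r' hr' => if_neg fun h => hr' (hr.eq_of_mem_hull h.2.1 hu h.2.2.1).1.symm
    · exact fun c' hc' => sum_eq_zero fun r' _ => if_neg fun h =>
        hc' (hr.eq_of_mem_hull h.2.1 hu h.2.2.1).2.symm
  · rw [sum_eq_zero fun c _ => sum_eq_zero fun r _ => if_neg fun h' =>
      h ⟨c, atoms_label_eq_color.2 ⟨h'.1, r, h'.2⟩⟩]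
    cases hl : φ.atoms.label u v with
    | color c => exact absurd ⟨c, hl⟩ h
    | _ => rfl

lemma comp_code_atoms (hu : Comp fun I γ => (u I γ : ℕ)) (hv : Comp fun I γ => (v I γ : ℕ)) :
    Comp fun I γ => (I.φ.atoms.label (u I γ) (v I γ)).code := by
  classical
  simp only [code_atoms]
  refine Comp.sum .numColors (Comp.sum .numVertices ?_)
  exact Comp.ite ((decid_vertex_eq hu.weaken.weaken hv.weaken.weaken).not.and
      ((decid_isRep .vertex Comp.color.weaken).and
        ((decid_mem_hull .vertex Comp.color.weaken hu.weaken.weaken).and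
          (decid_mem_hull .vertex Comp.color.weaken hv.weaken.weaken))))
    (Comp.color.weaken.add (.const 1))

lemma comp_deg (hu : Comp fun I γ => (u I γ : ℕ)) : Comp fun I γ => I.φ.deg (u I γ) := by
  unfold EdgeColoring.deg
  refine Comp.card_filter .numVertices ?_
  exact (decid_vertex_eq .vertex hu.weaken).not.and (decid_label_ne_gamma hu.weaken .vertex)

lemma comp_weight (hu : Comp fun I γ => (u I γ : ℕ)) (hv : Comp fun I γ => (v I γ : ℕ))
    (hc : Comp fun I γ => (c I γ : ℕ)) : Comp fun I γ => I.φ.weight (u I γ) (v I γ) (c I γ) := by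
  unfold EdgeColoring.weight
  refine Comp.sum .numVertices ?_
  exact Comp.ite ((decid_label_eq_color hu.weaken .vertex hc.weaken).and
      (decid_label_ne_gamma hv.weaken .vertex))
    (Comp.numVertices_div ((comp_deg .vertex).add (.const 1)))

lemma decid_isReachable (hu : Comp fun I γ => (u I γ : ℕ)) (hv : Comp fun I γ => (v I γ : ℕ))
    (hc : Comp fun I γ => (c I γ : ℕ)) :
    Decid fun I γ => I.φ.IsReachable I.k (u I γ) (v I γ) (c I γ) :=
  (decid_isAtomVertex hu).not.and ((decid_isAtomVertex hv).not.and
    ((decid_vertex_eq hv hu).not.and (Decid.le .numVertices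
      (((Comp.const 128).mul (Comp.precision.mul .precision)).mul (comp_weight hu hv hc)))))

lemma decid_isAttached (hu : Comp fun I γ => (u I γ : ℕ)) (hv : Comp fun I γ => (v I γ : ℕ))
    (hc : Comp fun I γ => (c I γ : ℕ)) :
    Decid fun I γ => I.φ.IsAttached (u I γ) (v I γ) (c I γ) := by
  classical
  refine (decid_isAtomVertex hu).not.and (Decid.exists .numVertices
    ((decid_isRep .vertex hc.weaken).and
      ((decid_mem_hull .vertex hc.weaken hv.weaken).and (Decid.le
        (comp_card_hull .vertex hc.weaken) ((Comp.const 4).mul ?_)))))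
  convert Comp.card_filter .numVertices (p := fun I (γ : Γ I × Fin I.n) w =>
      w ∈ I.φ.hull γ.2 (c I γ.1) ∧ I.φ.label (u I γ.1) w ≠ .gamma)
    ((decid_mem_hull Comp.vertex.weaken hc.weaken.weaken .vertex).and
      (decid_label_ne_gamma hu.weaken.weaken .vertex)) using 3 with I γ
  rw [← filter_filter, filter_mem_eq_inter, univ_inter]

lemma decid_mem_admissible (hu : Comp fun I γ => (u I γ : ℕ)) (hv : Comp fun I γ => (v I γ : ℕ))
    (hc : Comp fun I γ => (c I γ : ℕ)) :
    Decid fun I γ => s(u I γ, v I γ) ∈ I.φ.admissible I.k (c I γ) := by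
  simp only [mem_admissible]
  exact ((decid_isReachable hu hv hc).or (decid_isAttached hu hv hc)).or
    ((decid_isReachable hv hu hc).or (decid_isAttached hv hu hc))

end algorithm

/-- The program fills the arrays `2` and `3`. An index is decoded by a search for the coordinates
that it encodes. -/
lemma exists_program : ∃ (alg : Program) (C : ℕ), ∀ I : Input, ∃ t s,
    Runs alg (inputState I.φ I.k) t s ∧ t ≤ I.size ^ C ∧
      IsOutput s I.φ.atoms (I.φ.admissible I.k) := by
  classical
  have hn := LoopBound.numVertices
  have hl := LoopBound.numColors
  let F₂ : ∀ I : Input, Fin (I.n * I.n) → ℕ := fun I i => ∑ u : Fin I.n, ∑ v : Fin I.n,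
    if (u : ℕ) * I.n + v = i then (I.φ.atoms.label u v).code else 0
  let F₃ : ∀ I : Input, Fin (I.l * I.n * I.n) → ℕ := fun I i =>
    ∑ c : Fin I.l, ∑ u : Fin I.n, ∑ v : Fin I.n,
      if (((c : ℕ) * I.n + u) * I.n + v = i) ∧ s(u, v) ∈ I.φ.admissible I.k c then 1 else 0
  have h₂ : Comp fun (I : Input) (p : Unit × Fin (I.n * I.n)) => F₂ I p.2 := by
    refine Comp.sum hn (Comp.sum hn ?_)
    exact Comp.ite (Decid.eq ((Comp.vertex.weaken.mul .numVertices).add .vertex)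
      (Comp.var (hn.mul hn)).weaken.weaken) (comp_code_atoms Comp.vertex.weaken .vertex)
  have h₃ : Comp fun (I : Input) (p : Unit × Fin (I.l * I.n * I.n)) => F₃ I p.2 := by
    refine Comp.sum hl (Comp.sum hn (Comp.sum hn ?_))
    exact Comp.ite ((Decid.eq ((((Comp.color.weaken.weaken.mul .numVertices).add
      Comp.vertex.weaken).mul .numVertices).add .vertex)
      (Comp.var ((hl.mul hn).mul hn)).weaken.weaken.weaken).and
      (decid_mem_admissible Comp.vertex.weaken .vertex Comp.color.weaken.weaken)) (.const 1)
  obtain ⟨P₂, C₂, hP₂⟩ := h₂.exists_fill (hn.mul hn) 2 (by decide) (by decide) (by decide)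
  obtain ⟨P₃, C₃, hP₃⟩ := h₃.exists_fill ((hl.mul hn).mul hn) 3 (by decide) (by decide) (by decide)
  refine ⟨.seq P₂ P₃, C₂ + C₃ + 1, fun I => ?_⟩
  obtain ⟨t, s, hr, ht, hv, hs⟩ := hP₂ I (inputState I.φ I.k) ⟨rfl, rfl⟩
  obtain ⟨t', s', hr', ht', hv', hs'⟩ := hP₃ I s
    ⟨hs 0 (by decide) (by decide), hs 1 (by decide) (by decide)⟩
  have hlt : ∀ {a b : ℕ} (u : Fin a) (v : Fin b), (u : ℕ) * b + v < a * b := by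
    intro a b u v
    calc (u : ℕ) * b + v < u * b + b := Nat.add_lt_add_left v.isLt _
      _ = (u + 1) * b := by ring
      _ ≤ a * b := Nat.mul_le_mul_right _ u.isLt
  have hinj : ∀ {a b b' : ℕ} (v v' : Fin a), b * a + v = b' * a + v' → b = b' ∧ v = v' := by
    intro a b b' v v' h
    have ha : 0 < a := v.pos
    have h1 : b = b' := by
      have := congrArg (· / a) h
      simpa [Nat.add_comm (_ * a), Nat.add_mul_div_right _ _ ha,
        Nat.div_eq_of_lt v.isLt, Nat.div_eq_of_lt v'.isLt] using this
    exact ⟨h1, Fin.ext (by subst h1; omega)⟩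
  refine ⟨t + t', s', Runs.seq hr hr', I.add_le_size_pow ht ht', fun u v => ?_, fun c u v => ?_⟩
  · rw [hs' 2 (by decide) (by decide)]
    refine (hv ⟨_, hlt u v⟩).trans ?_
    dsimp only [F₂]
    rw [Fintype.sum_eq_single u, Fintype.sum_eq_single v, if_pos rfl]
    · exact fun v' hne => if_neg fun h => hne (hinj _ _ h).2
    · exact fun u' hne => sum_eq_zero fun v' _ => if_neg fun h => hne (Fin.ext (hinj _ _ h).1)
  · refine (hv' ⟨_, hlt (⟨_, hlt c u⟩ : Fin (I.l * I.n)) v⟩).trans ?_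
    dsimp only [F₃]
    rw [Fintype.sum_eq_single c, Fintype.sum_eq_single u, Fintype.sum_eq_single v]
    · exact if_congr (by simp) rfl rfl
    · exact fun v' hne => if_neg fun h => hne (hinj _ _ h.1).2
    · exact fun u' hne => sum_eq_zero fun v' _ => if_neg fun h =>
        hne (hinj _ _ (hinj _ _ h.1).1).2
    · exact fun c' hne => sum_eq_zero fun u' _ => sum_eq_zero fun v' _ => if_neg fun h =>
        hne (Fin.ext (hinj _ _ (hinj _ _ h.1).1).1)

lemma exists_obj_eq_opt {n ℓ : ℕ} (φ : EdgeColoring n ℓ) :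
    ∃ Φ : ChromaticClustering n ℓ, φ.obj Φ = φ.opt ∧
      ∀ Ψ, (φ.errs Φ).card ≤ (φ.errs Ψ).card := by
  obtain ⟨Φ, hΦ⟩ := ciInf_mem fun Φ : ChromaticClustering n ℓ => φ.obj Φ
  refine ⟨Φ, hΦ, fun Ψ => ?_⟩
  rw [card_errs_eq_two_mul_obj, card_errs_eq_two_mul_obj]
  exact Nat.mul_le_mul_left 2 (hΦ.trans_le (ciInf_le' _ Ψ))

end CCC

theorem theorem4 :
    ∃ (alg : CCC.Program) (A B : ℝ) (d : ℕ),
      ∀ (n ℓ : ℕ) (φ : CCC.EdgeColoring n ℓ) (ε : ℝ), 0 < ε → ε ≤ 1 →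
        ∃ (t : ℕ) (s : CCC.State) (Φp : CCC.ChromaticClustering n ℓ)
          (E2 : Fin ℓ → Finset (Sym2 (Fin n))),
          -- the algorithm halts in polynomial time with output `(Φp, E2)`
          CCC.Runs alg (CCC.inputState φ ⌈1 / ε⌉₊) t s ∧
          (t : ℝ) ≤ A * ((n : ℝ) + (ℓ : ℝ) + 1 / ε) ^ d ∧
          CCC.IsOutput s Φp E2 ∧
          -- `Φp` is a clustering by atoms, and admissible edges join different atoms
          Φp.IsAtomic φ ∧
          (∀ (c : Fin ℓ) (u v : Fin n), s(u, v) ∈ E2 c → v ∉ Φp.clusterOf u) ∧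
          -- a near-optimal clustering that respects the atoms and the admissible edges
          (∃ Φ1 : CCC.ChromaticClustering n ℓ,
            (φ.obj Φ1 : ℝ) ≤ (1 + ε) * (φ.opt : ℝ) ∧
            Φ1.DoesNotBreak Φp ∧
            ∀ (u v : Fin n) (c : Fin ℓ), Φ1.label u v = CCC.Label.color c →
              v ∈ Φp.clusterOf u ∨ s(u, v) ∈ E2 c) ∧
          -- few admissible edges, counted with colours
          ((∑ c : Fin ℓ, (E2 c).card : ℕ) : ℝ) ≤ B / ε ^ 2 * (φ.opt : ℝ) := by
  classical
  obtain ⟨alg, C, halg⟩ := CCC.exists_program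
  refine ⟨alg, 4 ^ C, 1056 * 10 ^ 7, C, fun n ℓ φ ε hε hε1 => ?_⟩
  have hinv : 1 ≤ 1 / ε := (one_le_div hε).2 hε1
  set k := ⌈1 / ε⌉₊ with hk
  have hk1 : 1 / ε ≤ k := Nat.le_ceil _
  have hk2 : (k : ℝ) ≤ 2 / ε := by
    have := Nat.ceil_lt_add_one (zero_le_one.trans hinv)
    rw [← hk] at this
    have h2 : 2 / ε = 1 / ε + 1 / ε := by ring
    linarith
  have hkpos : 1 ≤ k := by exact_mod_cast hinv.trans hk1
  obtain ⟨t, s, hr, ht, hout⟩ := halg ⟨n, ℓ, φ, k⟩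
  obtain ⟨Φ, hΦ, hopt⟩ := CCC.exists_obj_eq_opt φ
  obtain ⟨Φ₁, herr, hbreak, hadm⟩ := CCC.exists_nearOptimal hkpos hopt
  refine ⟨t, s, φ.atoms, φ.admissible k, hr, ?_, hout, CCC.isAtomic_atoms,
    fun c u v h => CCC.notMem_clusterOf_of_mem_admissible h, ⟨Φ₁, ?_, hbreak, hadm⟩, ?_⟩
  · have h1 : ((CCC.Input.size ⟨n, ℓ, φ, k⟩ : ℕ) : ℝ) ≤ 4 * (n + ℓ + 1 / ε) := by
      have h2 : 2 / ε = 2 * (1 / ε) := by ring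
      have h3 : (0 : ℝ) ≤ n := Nat.cast_nonneg n
      have h4 : (0 : ℝ) ≤ ℓ := Nat.cast_nonneg ℓ
      simp only [CCC.Input.size]
      push_cast
      linarith
    calc (t : ℝ) ≤ ((CCC.Input.size ⟨n, ℓ, φ, k⟩ : ℕ) : ℝ) ^ C := by exact_mod_cast ht
      _ ≤ (4 * (n + ℓ + 1 / ε)) ^ C := pow_le_pow_left₀ (Nat.cast_nonneg _) h1 C
      _ = _ := mul_pow _ _ _
  · rw [CCC.card_errs_eq_two_mul_obj, CCC.card_errs_eq_two_mul_obj, hΦ] at herr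
    have h1 : 2 * k * (2 * φ.obj Φ₁ : ℝ) ≤ 2 * k * (2 * φ.opt) + 2 * φ.obj Φ₁ := by
      exact_mod_cast herr
    have h2 : 1 ≤ k * ε := (div_le_iff₀ hε).1 hk1
    have h3 : (1 : ℝ) ≤ k := by exact_mod_cast hkpos
    have h4 : (0 : ℝ) ≤ φ.opt := Nat.cast_nonneg _
    -- `2 * k ≤ (1 + ε) * (2 * k - 1)`, because `1 ≤ k * ε` and `ε ≤ 1`
    have h5 : (2 * k - 1) * (φ.obj Φ₁ : ℝ) ≤ (2 * k - 1) * ((1 + ε) * φ.opt) := by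
      nlinarith [mul_nonneg h4 (show 0 ≤ 2 * (k * ε) - 1 - ε by linarith)]
    exact le_of_mul_le_mul_left h5 (by linarith)
  · have h1 := CCC.sum_card_admissible_le (φ := φ) k
    have h2 := CCC.sum_deg_le (φ := φ) Φ (Finset.univ.filter fun u => ¬ φ.IsAtomVertex u)
      fun u hu => (Finset.mem_filter.1 hu).2
    rw [CCC.card_errs_eq_two_mul_obj, hΦ] at h2
    push_cast at h2
    have h3 : ((∑ c : Fin ℓ, (φ.admissible k c).card : ℕ) : ℝ) ≤ (128 * (k * k) + 4) *
        ∑ u ∈ Finset.univ.filter fun u => ¬ φ.IsAtomVertex u, (φ.deg u : ℝ) := by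
      exact_mod_cast h1
    have h4 : (1 : ℝ) ≤ k := by exact_mod_cast hkpos
    have h5 : (128 * ((k : ℝ) * k) + 4) ≤ 528 / ε ^ 2 := by
      have h6 : (k : ℝ) * k ≤ 2 / ε * (2 / ε) :=
        mul_le_mul hk2 hk2 (by linarith) (by positivity)
      have h7 : 528 / ε ^ 2 = 132 * (2 / ε * (2 / ε)) := by field_simp; norm_num
      nlinarith
    calc _ ≤ _ := h3
      _ ≤ 528 / ε ^ 2 * (10 ^ 7 * (2 * φ.opt)) :=
        mul_le_mul h5 h2 (Finset.sum_nonneg fun _ _ => Nat.cast_nonneg _) (by positivity)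
      _ = _ := by ring
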